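/- **Conventions.** A function $u:\mathbb R_{\ge 0}\to\mathbb R_{\ge 1}$ is *admissible* if it is nondecreasing, doubling ($\limsup_{r\to\infty}u(2r)/u(r)<\infty$) and sublinear ($u(r)/r\to 0$ as $r\to\infty$). In a pointed metric space $(Y,o)$ write $|x-y|$ for the distance, $|x|=|x-o|$, and $(x\mid y)_o=\frac12(|x|+|y|-|x-y|)$. $Y$ is $\delta$-hyperbolic if $(x_1\mid x_3)_{x_0}\ge\min\{(x_1\mid x_2)_{x_0},(x_2\mid x_3)_{x_0}\}-\delta$ for all $x_0,\dots,x_3\in Y$. The boundary $\partial_\infty Y$ is the set of Cauchy–Gromov sequences ($(x_n\mid x_m)_o\to\infty$ as $n,m\to\infty$) modulo $(x_n)\sim(y_n)\iff (x_n\mid y_n)_o\to\infty$; for $\xi,\eta\in\partial_\infty Y$ let $(\xi\mid\eta)_o=\sup\liminf_{i,j\to\infty}(x_i\mid y_j)_o$, the supremum being over sequences $(x_i)$, $(y_j)$ representing $\xi$, $\eta$. For four distinct boundary points, $\overline{\boxtimes}\{\cdot\}$ and $\underline{\boxtimes}\{\cdot\}$ denote the largest and the smallest Gromov product $(\cdot\mid\cdot)_o$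 over the pairs of distinct points among them. For $\lambda=(\underline\lambda,\overline\lambda)\in\mathbb R_{>0}^2$, a *$(\lambda,w)$-geodesic* is a map $c:\mathbb R\to Y$ with $$\underline\lambda|s-t|-w(\max(|s|,|t|))\le|c(s)-c(t)|\le\overline\lambda|s-t|+w(\max(|s|,|t|))\qquad(s,t\in\mathbb R),$$ and its endpoints $\partial_\infty c(\pm\infty)$ are the classes of the sequences $(c(\pm n))_n$. A *geodesic* $\mathbb R\to Y$ is an isometric embedding; its endpoints $\gamma(\pm\infty)$ are defined in the same way. The distance between two curves is the infimum of the distances between their points. **Statement.** Let $v^1,v^2$ be admissible, $v=\max(v^1,v^2)$, $L>1$, $\delta\ge0$ and $\lambda=(\underline\lambda,\overline\lambda)\in\mathbb R_{>0}^2$. There exist positive constants $J=J(\delta,\lambda,v,L)$, $R=R(\delta,\lambda,v,L)$ and $\widetilde R^i=\widetilde R^i(\delta,\lambda,v^i,L)$ for $i\in\{1,2\}$, depending only on the indicated data, where moreover $J=J(\lambda,v,L)$ does not depend on $\delta$ whenever $v$ is unbounded, such that the following holds. Let $(Y,o)$ be a pointed, proper, geodesic, $\delta$-hyperbolic metric space,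 and let $\gamma_1,\gamma_2,\widetilde\gamma_1,\widetilde\gamma_2:\mathbb R\to Y$ be such that 1. $\gamma_1,\gamma_2$ are geodesics with four distinct endpoints $\eta_i^\pm=\gamma_i(\pm\infty)$; 2. for $i\in\{1,2\}$, $\widetilde\gamma_i$ is a $(\lambda,v^i)$-geodesic; 3. for $i\in\{1,2\}$, $\partial_\infty\widetilde\gamma_i(\pm\infty)=\eta_i^\pm$; 4. $\underline{\boxtimes}\{\eta_1^\pm,\eta_2^\pm\}\ge60\delta$ and $\overline{\boxtimes}\{\eta_1^\pm,\eta_2^\pm\}\ge R$; 5. for $i\in\{1,2\}$, $\widetilde R^i\le|\widetilde\gamma_i(0)|\le L\inf_{t\in\mathbb R}|\widetilde\gamma_i(t)|$. Then $$\bigl|d(\gamma_1,\gamma_2)-d(\widetilde\gamma_1,\widetilde\gamma_2)\bigr|\le J\,v\bigl(\overline{\boxtimes}\{\eta_1^\pm,\eta_2^\pm\}\bigr).$$ -/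

import Mathlib

open Filter Topology
open scoped NNReal ENNReal

/-- Admissible functions `u : ℝ≥0 → ℝ≥1`: nondecreasing, doubling
(`limsup u(2r)/u(r) < ∞`) and sublinear (`u(r) = o(r)`). -/
structure IsAdmissible (u : ℝ≥0 → ℝ) : Prop where
  one_le : ∀ r, 1 ≤ u r
  mono : Monotone u
  doubling : IsBoundedUnder (· ≤ ·) atTop (fun r : ℝ≥0 => u (2 * r) / u r)
  sublinear : u =o[atTop] (fun r : ℝ≥0 => (r : ℝ))

section Hyperbolic

variable {Y : Type*} [MetricSpace Y]

/-- The Gromov product `(x | y)_o`. -/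
noncomputable def gromovProd (o x y : Y) : ℝ := (dist o x + dist o y - dist x y) / 2

/-- `δ`-hyperbolicity, in the sense of the four point inequality for Gromov products. -/
def IsGromovHyperbolic (Y : Type*) [MetricSpace Y] (δ : ℝ) : Prop :=
  ∀ x₀ x₁ x₂ x₃ : Y,
    min (gromovProd x₀ x₁ x₂) (gromovProd x₀ x₂ x₃) - δ ≤ gromovProd x₀ x₁ x₃

/-- Geodesic spaces: any two points are joined by a geodesic segment. -/
def IsGeodesicSpace (Y : Type*) [MetricSpace Y] : Prop :=
  ∀ x y : Y, ∃ c : ℝ → Y, c 0 = x ∧ c (dist x y) = y ∧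
    ∀ s ∈ Set.Icc 0 (dist x y), ∀ t ∈ Set.Icc 0 (dist x y), dist (c s) (c t) = |s - t|

/-- Cauchy-Gromov sequences: `(x_n | x_m)_o → ∞` as `n, m → ∞`. -/
def IsCauchyGromov (o : Y) (x : ℕ → Y) : Prop :=
  Tendsto (fun p : ℕ × ℕ => gromovProd o (x p.1) (x p.2)) atTop atTop

/-- The type of Cauchy-Gromov sequences. -/
def CauchyGromovSeq (o : Y) : Type _ := {x : ℕ → Y // IsCauchyGromov o x}

/-- Equivalence of Cauchy-Gromov sequences: `(x_n | y_n)_o → ∞` as `n → ∞`. -/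
def CauchyGromovSeq.Equiv {o : Y} (x y : CauchyGromovSeq o) : Prop :=
  Tendsto (fun n : ℕ => gromovProd o (x.1 n) (y.1 n)) atTop atTop

/-- The Gromov boundary of the pointed space `(Y, o)`: Cauchy-Gromov sequences up to equivalence.
(In a hyperbolic space the relation is an equivalence relation, see
`CauchyGromovSeq.equivalence_equiv`.) -/
def GromovBoundary (o : Y) : Type _ := Quot (CauchyGromovSeq.Equiv (o := o))

/-- The Gromov product of two points at infinity,
`(ξ | η)_o = sup liminf_{i, j → ∞} (x_i | y_j)_o`, where the supremum is over the sequences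
`(x_i)`, `(y_j)` that represent `ξ` and `η`; it takes values in `[0, ∞]`. -/
noncomputable def boundaryProd {o : Y} (ξ η : GromovBoundary o) : ℝ≥0∞ :=
  ⨆ (x : CauchyGromovSeq o) (y : CauchyGromovSeq o)
    (_ : Quot.mk _ x = ξ) (_ : Quot.mk _ y = η),
    liminf (fun p : ℕ × ℕ => ENNReal.ofReal (gromovProd o (x.1 p.1) (y.1 p.2))) atTop

/-- The largest Gromov product over pairs of distinct indices. -/
noncomputable def maxProd {o : Y} (η : Fin 4 → GromovBoundary o) : ℝ≥0∞ :=
  ⨆ (i : Fin 4) (j : Fin 4) (_ : i ≠ j), boundaryProd (η i) (η j)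

/-- The smallest Gromov product over pairs of distinct indices. -/
noncomputable def minProd {o : Y} (η : Fin 4 → GromovBoundary o) : ℝ≥0∞ :=
  ⨅ (i : Fin 4) (j : Fin 4) (_ : i ≠ j), boundaryProd (η i) (η j)

/-- The sequence `x` represents the point at infinity `η`. -/
def Represents {o : Y} (x : ℕ → Y) (η : GromovBoundary o) : Prop :=
  ∃ h : IsCauchyGromov o x, (Quot.mk _ ⟨x, h⟩ : GromovBoundary o) = η

/-- `η` is the endpoint at `+∞` of `c : ℝ → Y`, i.e. the image of the point `+∞ = [(n)]` of the
boundary of `ℝ` under the boundary map of `c`. -/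
def HasEndpointPos {o : Y} (c : ℝ → Y) (η : GromovBoundary o) : Prop :=
  Represents (fun n : ℕ => c n) η

/-- `η` is the endpoint at `-∞` of `c : ℝ → Y`, i.e. the image of the point `-∞ = [(-n)]` of the
boundary of `ℝ` under the boundary map of `c`. -/
def HasEndpointNeg {o : Y} (c : ℝ → Y) (η : GromovBoundary o) : Prop :=
  Represents (fun n : ℕ => c (-n)) η

/-- A `(lam.1, lam.2, v)`-embedding of a pointed metric space `(X, x₀)` into `Y`: `lam.1` is the
expansion constant, `lam.2` the Lipschitz constant, `v` the additive error as a function of the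
larger of the distances to the base-point of `X`. -/
def IsSublinearEmbedding {X : Type*} [MetricSpace X] (x₀ : X) (lam : ℝ × ℝ) (v : ℝ≥0 → ℝ)
    (f : X → Y) : Prop :=
  ∀ x x' : X,
    lam.1 * dist x x' - v (max (nndist x₀ x) (nndist x₀ x')) ≤ dist (f x) (f x') ∧
    dist (f x) (f x') ≤ lam.2 * dist x x' + v (max (nndist x₀ x) (nndist x₀ x'))

/-- `(lam, v)`-geodesics: `(lam.1, lam.2, v)`-embeddings of `(ℝ, 0)`. -/
def IsSublinearGeodesic (lam : ℝ × ℝ) (v : ℝ≥0 → ℝ) (c : ℝ → Y) : Prop :=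
  IsSublinearEmbedding (0 : ℝ) lam v c

/-- The distance `inf_{s, t} d(c s, c' t)` between (the images of) two curves. -/
noncomputable def curveDist (c c' : ℝ → Y) : ℝ := ⨅ p : ℝ × ℝ, dist (c p.1) (c' p.2)

theorem gromovProd_comm (o x y : Y) : gromovProd o x y = gromovProd o y x := by
  unfold gromovProd; rw [dist_comm x y]; ring

/-- In a hyperbolic space, equivalence of Cauchy-Gromov sequences is an equivalence relation. -/
theorem CauchyGromovSeq.equivalence_equiv {δ : ℝ} (hY : IsGromovHyperbolic Y δ) (o : Y) :
    Equivalence (CauchyGromovSeq.Equiv (o := o)) where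
  refl x := by
    have hd : Tendsto (fun n : ℕ => (n, n)) atTop (atTop : Filter (ℕ × ℕ)) := by
      rw [← prod_atTop_atTop_eq]
      exact tendsto_id.prodMk tendsto_id
    exact Tendsto.comp x.2 hd
  symm {x y} h := by
    unfold CauchyGromovSeq.Equiv at h ⊢
    simpa only [gromovProd_comm o (y.1 _) (x.1 _)] using h
  trans {x y z} h h' := by
    unfold CauchyGromovSeq.Equiv at h h' ⊢
    rw [tendsto_atTop] at h h' ⊢
    intro b
    filter_upwards [h (b + δ), h' (b + δ)] with n h1 h2
    have := hY o (x.1 n) (y.1 n) (z.1 n)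
    have := le_min h1 h2
    linarith

/-- In a hyperbolic space, the Gromov product of two distinct points at infinity is finite. -/
theorem boundaryProd_ne_top {δ : ℝ} (hY : IsGromovHyperbolic Y δ) {o : Y}
    {ξ η : GromovBoundary o} (hne : ξ ≠ η) : boundaryProd ξ η ≠ ⊤ := by
  have hE := CauchyGromovSeq.equivalence_equiv hY o
  have hq : ∀ x y : CauchyGromovSeq o,
      (Quot.mk _ x : GromovBoundary o) = Quot.mk _ y → x.Equiv y := by
    intro x y h
    exact (hE.eqvGen_iff).1 (Quot.eqvGen_exact h)
  obtain ⟨x₀, rfl⟩ := Quot.exists_rep ξ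
  obtain ⟨y₀, rfl⟩ := Quot.exists_rep η
  have hn : ¬ x₀.Equiv y₀ := fun h => hne (Quot.sound h)
  unfold CauchyGromovSeq.Equiv at hn
  rw [tendsto_atTop] at hn
  push Not at hn
  obtain ⟨M, hM⟩ := hn
  have joint : ∀ x z : CauchyGromovSeq o, x.Equiv z →
      ∀ b : ℝ, ∃ N : ℕ, ∀ i ≥ N, ∀ n ≥ N, b ≤ gromovProd o (x.1 i) (z.1 n) := by
    intro x z h b
    unfold CauchyGromovSeq.Equiv at h
    rw [tendsto_atTop] at h
    obtain ⟨N₁, h₁⟩ := eventually_atTop.1 (h (b + δ))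
    obtain ⟨⟨a, c⟩, h₂⟩ := eventually_atTop.1 ((tendsto_atTop.1 x.2) (b + δ))
    refine ⟨max N₁ (max a c), fun i hi n hn => ?_⟩
    have e1 := h₁ n (by omega)
    have e2 := h₂ (i, n) (Prod.mk_le_mk.2 ⟨by omega, by omega⟩)
    have := hY o (x.1 i) (x.1 n) (z.1 n)
    have := le_min e2 e1
    linarith
  refine ne_top_of_le_ne_top (ENNReal.ofReal_ne_top (r := M + 2 * δ)) ?_
  refine iSup_le fun x => iSup_le fun y => iSup_le fun hx => iSup_le fun hy => ?_
  obtain ⟨N₁, h₁⟩ := joint x₀ x (hE.symm (hq _ _ hx)) (M + 2 * δ)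
  obtain ⟨N₂, h₂⟩ := joint y y₀ (hq _ _ hy) (M + 2 * δ)
  refine liminf_le_of_frequently_le' (Eventually.frequently ?_)
  filter_upwards [eventually_ge_atTop (max N₁ N₂, max N₁ N₂)] with p hp
  obtain ⟨n, hn, hnM⟩ := (frequently_atTop.1 hM) (max N₁ N₂)
  obtain ⟨hp1, hp2⟩ := hp
  simp only at hp1 hp2
  apply ENNReal.ofReal_le_ofReal
  by_contra hlt
  push Not at hlt
  have e1 := h₁ n (by omega) p.1 (by omega)
  have e2 := h₂ p.2 (by omega) n (by omega)
  have f1 := hY o (x₀.1 n) (x.1 p.1) (y₀.1 n)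
  have f2 := hY o (x.1 p.1) (y.1 p.2) (y₀.1 n)
  have g2 := le_min hlt.le e2
  have g1 : M + δ ≤ min (gromovProd o (x₀.1 n) (x.1 p.1)) (gromovProd o (x.1 p.1) (y₀.1 n)) := by
    have hδ : 0 ≤ δ := by
      have := hY o o o o
      simp [gromovProd] at this
      exact this
    exact le_min (by linarith) (by linarith)
  linarith

end Hyperbolic

/-! ### Elementary estimates for Gromov products. -/

section GromovProduct

variable {Y : Type*} [MetricSpace Y] {δ : ℝ}

/-! The engine is a Morse lemma with linear dependence on the additive error: for `K ≥ δ`, an `(l₁,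
l₂, K)`-quasi-geodesic segment and a geodesic between its ends stay within a multiple of `K` of each
other, the factor depending on `l₁`, `l₂` only (`exists_hasMorseConstant`). On `[-T, T]` a sublinear
geodesic `c` is a quasi-geodesic with additive error `v T`, so its Morse constant there is `H * (v T
+ δ)`, which is small compared to `T`. Seen from a point within a small multiple of `T` of `c 0`,
the points `c (±T)` lie in the directions of the ends of `c`. This transfers the Morse estimate to
the bi-infinite geodesic, in both directions: `IsLargeScale.exists_dist_le` and
`IsLargeScale.eventually_gromovProd_le`.

Let `M` be the largest Gromov product of the endpoints. It remains to see that only scales `T`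
comparable to `M` matter. Both geodesics pass within about `2 * M` of `o`, and the proximity
condition then places each `c i 0` within `8 * L * M` of `o` (`IsComparisonScale.dist_zero_le`). As
the Gromov products across the two lines are bounded, points near different lines are far apart once
one of them is much further than `M` from `o` (`IsGromovHyperbolic.le_dist_of_near_lines`). So the
distances between the curves are decided within a multiple of `M` of `o`, where curve and geodesic
differ by `O(v T + δ)`, and doubling gives `v T ≤ D * v M`.

The result is a bound by a multiple of `v M + δ` whose factor does not involve `δ`. If `v` is
unbounded, a large threshold `R` forces `δ ≤ v M`; otherwise `1 ≤ v` absorbs `δ` into the constant.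
-/

theorem gromovProd_nonneg (o x y : Y) : 0 ≤ gromovProd o x y := by
  unfold gromovProd
  linarith [dist_triangle_left x y o]

theorem gromovProd_le_dist_left (o x y : Y) : gromovProd o x y ≤ dist o x := by
  unfold gromovProd
  linarith [dist_triangle o x y]

theorem dist_sub_dist_le_gromovProd (o x y : Y) : dist o x - dist x y ≤ gromovProd o x y := by
  unfold gromovProd
  linarith [dist_triangle_right o x y]

theorem gromovProd_le_add_dist (p q x y : Y) :
    gromovProd p x y ≤ gromovProd q x y + dist p q := by
  unfold gromovProd
  linarith [dist_triangle p q x, dist_triangle p q y]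

theorem gromovProd_add_gromovProd (o x y : Y) :
    gromovProd o x y + gromovProd x o y = dist o x := by
  unfold gromovProd
  rw [dist_comm x o]
  ring

theorem dist_eq_gromovProd (o x y : Y) :
    dist x y = dist o x + dist o y - 2 * gromovProd o x y := by
  unfold gromovProd
  ring

theorem IsGromovHyperbolic.sub_le (hY : IsGromovHyperbolic Y δ) {p x y z : Y} {A : ℝ}
    (h₁ : A ≤ gromovProd p x y) (h₂ : A ≤ gromovProd p y z) : A - δ ≤ gromovProd p x z := by
  have := hY p x y z
  have := le_min h₁ h₂
  linarith

theorem IsGromovHyperbolic.sub_two_mul_le (hY : IsGromovHyperbolic Y δ) (hδ : 0 ≤ δ)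
    {p x y z w : Y} {A : ℝ} (h₁ : A ≤ gromovProd p x y) (h₂ : A ≤ gromovProd p y z)
    (h₃ : A ≤ gromovProd p z w) : A - 2 * δ ≤ gromovProd p x w := by
  have := hY.sub_le (A := A - δ) (hY.sub_le h₁ h₂) (by linarith)
  linarith

/-- A point of a geodesic between `x` and `y` is close to `p` if `(x | y)_p` is small. -/
theorem IsGromovHyperbolic.dist_le_of_mem_segment (hY : IsGromovHyperbolic Y δ) {p q x y : Y}
    (h₁ : dist x q = gromovProd x p y) (h₂ : dist x q + dist q y = dist x y) :
    dist p q ≤ gromovProd p x y + 2 * δ := by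
  have hq : gromovProd x q y = dist x q := by
    unfold gromovProd
    linarith
  have h := hY.sub_le (p := x) (x := p) (y := y) (z := q) (A := gromovProd x p y) le_rfl
    (by rw [gromovProd_comm x y q, hq, h₁])
  have h' := gromovProd_add_gromovProd p x y
  have h'' := dist_eq_gromovProd x p q
  rw [dist_comm x p] at h''
  linarith

/-- If the Gromov products of nearby points of a path are at least `A`, those of points at
parameter distance at most `2 ^ k` times as large are at least `A - k * δ`. -/
theorem IsGromovHyperbolic.sub_mul_le_of_path (hY : IsGromovHyperbolic Y δ)
    {c : ℝ → Y} {p : Y} {a b h A : ℝ}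
    (hc : ∀ s ∈ Set.Icc a b, ∀ t ∈ Set.Icc a b, |s - t| ≤ h → A ≤ gromovProd p (c s) (c t))
    (k : ℕ) : ∀ s ∈ Set.Icc a b, ∀ t ∈ Set.Icc a b, |s - t| ≤ 2 ^ k * h →
      A - k * δ ≤ gromovProd p (c s) (c t) := by
  induction k with
  | zero =>
    intro s hs t ht hst
    have := hc s hs t ht (by simpa using hst)
    simpa using this
  | succ k ih =>
    intro s hs t ht hst
    have hm : (s + t) / 2 ∈ Set.Icc a b :=
      ⟨by linarith [hs.1, ht.1], by linarith [hs.2, ht.2]⟩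
    rw [pow_succ] at hst
    have e₁ : |s - (s + t) / 2| ≤ 2 ^ k * h := by
      rw [show s - (s + t) / 2 = (s - t) / 2 by ring, abs_div, abs_two]
      linarith
    have e₂ : |(s + t) / 2 - t| ≤ 2 ^ k * h := by
      rw [show (s + t) / 2 - t = (s - t) / 2 by ring, abs_div, abs_two]
      linarith
    have := hY.sub_le (ih s hs _ hm e₁) (ih _ hm t ht e₂)
    push_cast
    linarith

end GromovProduct

/-! ### The Morse lemma for quasi-geodesic segments that need not be continuous. -/

section Morse

variable {Y : Type*} [MetricSpace Y] {δ : ℝ}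

/-- `c` is an `(l₁, l₂, K)`-quasi-geodesic on `[a, b]`. -/
def IsQuasiGeodesicOn (l₁ l₂ K : ℝ) (c : ℝ → Y) (a b : ℝ) : Prop :=
  ∀ s ∈ Set.Icc a b, ∀ t ∈ Set.Icc a b,
    l₁ * |s - t| - K ≤ dist (c s) (c t) ∧ dist (c s) (c t) ≤ l₂ * |s - t| + K

/-- `H * K` is a Morse constant for the `(l₁, l₂, K)`-quasi-geodesic segments with `δ ≤ K`. -/
def HasMorseConstant (Y : Type*) [MetricSpace Y] (l₁ l₂ δ H : ℝ) : Prop :=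
  ∀ (c : ℝ → Y) (a b K : ℝ), a ≤ b → 0 < K → δ ≤ K → IsQuasiGeodesicOn l₁ l₂ K c a b →
    (∀ p : Y, ∃ t ∈ Set.Icc a b, dist p (c t) ≤ gromovProd p (c a) (c b) + 2 * δ + H * K) ∧
    ∀ t ∈ Set.Icc a b, gromovProd (c t) (c a) (c b) ≤ H * K

/-- If the point of the segment furthest from the curve is at distance `D`, a detour along the curve
around it has parameter length linear in `D / K`. Halving it about `log (D / K)` times, at a cost of
`δ` each, shows that the two sides of the segment have positive Gromov product at that point, where
in fact it is zero. -/
theorem infDist_segment_le (hY : IsGromovHyperbolic Y δ) (hδ : 0 ≤ δ) {l₁ l₂ K : ℝ}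
    (hl₁ : 0 < l₁) (hl₂ : 0 < l₂) {k₀ : ℕ}
    (hk₀ : ∀ k : ℕ, k₀ ≤ k → l₂ / l₁ * (6 * k + 33) ≤ 2 ^ k)
    {c : ℝ → Y} {a b : ℝ} (hab : a ≤ b) (hK : 0 < K) (hδK : δ ≤ K)
    (hc : IsQuasiGeodesicOn l₁ l₂ K c a b) {σ : ℝ → Y} {ℓ : ℝ} (hℓ : 0 ≤ ℓ)
    (hσ₀ : σ 0 = c a) (hσ₁ : σ ℓ = c b)
    (hσ : ∀ s ∈ Set.Icc 0 ℓ, ∀ t ∈ Set.Icc 0 ℓ, dist (σ s) (σ t) = |s - t|) :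
    ∀ τ ∈ Set.Icc 0 ℓ, Metric.infDist (σ τ) (c '' Set.Icc a b) ≤ (k₀ + 5) * K := by
  have hσc : ContinuousOn σ (Set.Icc 0 ℓ) := by
    have : LipschitzOnWith 1 σ (Set.Icc 0 ℓ) :=
      LipschitzOnWith.of_dist_le_mul fun s hs t ht => by
        rw [hσ s hs t ht, Real.dist_eq]; simp
    exact this.continuousOn
  have hne : (c '' Set.Icc a b).Nonempty := ⟨c a, a, ⟨le_rfl, hab⟩, rfl⟩
  obtain ⟨τ₀, hτ₀, hmax⟩ := isCompact_Icc.exists_isMaxOn (Set.nonempty_Icc.2 hℓ)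
    ((Metric.continuous_infDist_pt (c '' Set.Icc a b)).comp_continuousOn hσc)
  set D := Metric.infDist (σ τ₀) (c '' Set.Icc a b) with hD
  have hmax' : ∀ τ ∈ Set.Icc 0 ℓ, Metric.infDist (σ τ) (c '' Set.Icc a b) ≤ D := hmax
  have hDc : ∀ s ∈ Set.Icc a b, D ≤ dist (σ τ₀) (c s) := fun s hs =>
    Metric.infDist_le_dist_of_mem ⟨s, hs, rfl⟩
  suffices h : D ≤ (k₀ + 5) * K from fun τ hτ => (hmax' τ hτ).trans h
  by_contra! hlt
  have hnear : ∀ τ ∈ Set.Icc 0 ℓ, ∃ s ∈ Set.Icc a b, dist (σ τ) (c s) < D + K := by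
    intro τ hτ
    obtain ⟨_, ⟨s, hs, rfl⟩, h⟩ :=
      (Metric.infDist_lt_iff hne).1 (lt_of_le_of_lt (hmax' τ hτ) (lt_add_of_pos_right D hK))
    exact ⟨s, hs, h⟩
  have hD0 : 0 < D := lt_of_le_of_lt (by positivity) hlt
  -- `k` measures `D` in units of `K`: the upper bound makes the detour linear in `k`, and the lower
  -- bound beats the total loss `2 * K + k * δ + 2 * δ`.
  obtain ⟨k, hk, hk₁, hk₂⟩ : ∃ k : ℕ, k₀ ≤ k ∧ (k + 4) * K < D ∧ D ≤ (k + 5) * K := by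
    have hx : (k₀ : ℝ) + 5 < D / K := by rwa [lt_div_iff₀ hK]
    have h₁ : k₀ + 5 < ⌈D / K⌉₊ := Nat.lt_ceil.2 (by push_cast; exact hx)
    obtain ⟨k, hk⟩ := Nat.exists_eq_add_of_le' (show 5 ≤ ⌈D / K⌉₊ by omega)
    have h₂ := Nat.le_ceil (D / K)
    have h₃ := Nat.ceil_lt_add_one (show 0 ≤ D / K by positivity)
    rw [hk] at h₂ h₃
    push_cast at h₂ h₃
    refine ⟨k, by omega, ?_, ?_⟩
    · rw [← lt_div_iff₀ hK]; linarith
    · rwa [← div_le_iff₀ hK]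
  -- At distance `2 * D` from `σ τ₀`, jumping to the curve costs less than `D + K` and leaves a
  -- product of at least `D - K`. If the segment is too short, its end already lies on the curve.
  obtain ⟨τ₁, hτ₁, hτ₁₀, s₁, hs₁, hp₁, hd₁⟩ : ∃ τ₁ ∈ Set.Icc 0 τ₀, τ₀ - τ₁ ≤ 2 * D ∧
      ∃ s ∈ Set.Icc a b, D - K ≤ gromovProd (σ τ₀) (σ τ₁) (c s) ∧ dist (σ τ₁) (c s) ≤ D + K := by
    by_cases h : 2 * D ≤ τ₀
    · have hm : τ₀ - 2 * D ∈ Set.Icc 0 ℓ := ⟨by linarith, by linarith [hτ₀.2]⟩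
      obtain ⟨s, hs, hd⟩ := hnear _ hm
      refine ⟨τ₀ - 2 * D, ⟨hm.1, by linarith⟩, by linarith, s, hs, ?_, hd.le⟩
      have := dist_sub_dist_le_gromovProd (σ τ₀) (σ (τ₀ - 2 * D)) (c s)
      rw [hσ _ hτ₀ _ hm, abs_of_nonneg (by linarith)] at this
      linarith
    · refine ⟨0, ⟨le_rfl, hτ₀.1⟩, by linarith, a, ⟨le_rfl, hab⟩, ?_, ?_⟩
      · have := dist_sub_dist_le_gromovProd (σ τ₀) (σ 0) (c a)
        have h' := hDc a ⟨le_rfl, hab⟩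
        rw [hσ₀, dist_self] at this
        rw [hσ₀]
        linarith
      · rw [hσ₀, dist_self]; linarith
  obtain ⟨τ₂, hτ₂, hτ₂₀, s₂, hs₂, hp₂, hd₂⟩ : ∃ τ₂ ∈ Set.Icc τ₀ ℓ, τ₂ - τ₀ ≤ 2 * D ∧
      ∃ s ∈ Set.Icc a b, D - K ≤ gromovProd (σ τ₀) (σ τ₂) (c s) ∧ dist (σ τ₂) (c s) ≤ D + K := by
    by_cases h : τ₀ + 2 * D ≤ ℓ
    · have hm : τ₀ + 2 * D ∈ Set.Icc 0 ℓ := ⟨by linarith [hτ₀.1], h⟩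
      obtain ⟨s, hs, hd⟩ := hnear _ hm
      refine ⟨τ₀ + 2 * D, ⟨by linarith, hm.2⟩, by linarith, s, hs, ?_, hd.le⟩
      have := dist_sub_dist_le_gromovProd (σ τ₀) (σ (τ₀ + 2 * D)) (c s)
      rw [hσ _ hτ₀ _ hm, abs_of_nonpos (by linarith)] at this
      linarith
    · refine ⟨ℓ, ⟨hτ₀.2, le_rfl⟩, by linarith, b, ⟨hab, le_rfl⟩, ?_, ?_⟩
      · have := dist_sub_dist_le_gromovProd (σ τ₀) (σ ℓ) (c b)
        have h' := hDc b ⟨hab, le_rfl⟩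
        rw [hσ₁, dist_self] at this
        rw [hσ₁]
        linarith
      · rw [hσ₁, dist_self]; linarith
  have hm₁ : τ₁ ∈ Set.Icc 0 ℓ := ⟨hτ₁.1, hτ₁.2.trans hτ₀.2⟩
  have hm₂ : τ₂ ∈ Set.Icc 0 ℓ := ⟨hτ₀.1.trans hτ₂.1, hτ₂.2⟩
  have hτ₁₂ : dist (σ τ₁) (σ τ₂) = τ₂ - τ₁ := by
    rw [hσ _ hm₁ _ hm₂, abs_of_nonpos (by linarith [hτ₁.2, hτ₂.1])]; ring
  have hzero : gromovProd (σ τ₀) (σ τ₁) (σ τ₂) = 0 := by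
    unfold gromovProd
    rw [hτ₁₂, hσ _ hτ₀ _ hm₁, hσ _ hτ₀ _ hm₂, abs_of_nonneg (by linarith [hτ₁.2]),
      abs_of_nonpos (by linarith [hτ₂.1])]
    ring
  -- Parameters at most `K / l₂` apart move `c` by at most `2 * K`, while all of `c` is at distance
  -- at least `D` from `σ τ₀`.
  have hpath := hY.sub_mul_le_of_path (c := c) (p := σ τ₀) (a := a) (b := b) (h := K / l₂)
    (A := D - 2 * K) (fun s hs t ht hst => by
      have h₁ := dist_sub_dist_le_gromovProd (σ τ₀) (c s) (c t)
      have h₂ := (hc s hs t ht).2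
      rw [le_div_iff₀ hl₂] at hst
      linarith [hDc s hs]) k s₁ hs₁ s₂ hs₂ (by
      have h₁ := (hc s₁ hs₁ s₂ hs₂).1
      have h₂ : dist (c s₁) (c s₂) ≤ dist (σ τ₁) (c s₁) + dist (σ τ₁) (σ τ₂)
          + dist (σ τ₂) (c s₂) := by
        have := dist_triangle4 (c s₁) (σ τ₁) (σ τ₂) (c s₂)
        rwa [dist_comm (c s₁) (σ τ₁)] at this
      -- The left side is at most `6 * D + 3 * K`, and `D ≤ (k + 5) * K`.
      have h₃ : l₁ * |s₁ - s₂| ≤ (6 * k + 33) * K := by linarith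
      have h₄ := mul_le_mul_of_nonneg_right (hk₀ k hk) hK.le
      rw [← mul_div_assoc, le_div_iff₀ hl₂]
      calc |s₁ - s₂| * l₂ = l₂ / l₁ * (l₁ * |s₁ - s₂|) := by field_simp
        _ ≤ l₂ / l₁ * ((6 * k + 33) * K) := by gcongr
        _ ≤ 2 ^ k * K := by linarith)
  have hkδ : (k : ℝ) * δ ≤ k * K := by gcongr
  have hkK : 0 ≤ (k : ℝ) * K := by positivity
  have := hY.sub_two_mul_le hδ (A := D - 2 * K - k * K) (by linarith) (by linarith)
    (by rw [gromovProd_comm]; linarith) (p := σ τ₀) (x := σ τ₁) (y := c s₁) (z := c s₂) (w := σ τ₂)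
  linarith

theorem exists_pow_ge (q : ℝ) : ∃ k₀ : ℕ, ∀ k : ℕ, k₀ ≤ k → q * (6 * k + 33) ≤ 2 ^ k := by
  have h₁ : Tendsto (fun k : ℕ => q * (6 * ((k : ℝ) ^ 1 / 2 ^ k) + 33 * (1 / 2) ^ k)) atTop
      (𝓝 (q * (6 * 0 + 33 * 0))) :=
    (((tendsto_pow_const_div_const_pow_of_one_lt 1 one_lt_two).const_mul 6).add
      ((tendsto_pow_atTop_nhds_zero_of_lt_one (by norm_num) (by norm_num)).const_mul 33)).const_mul q
  obtain ⟨k₀, hk₀⟩ := eventually_atTop.1 (h₁.eventually_le_const (u := 1) (by norm_num))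
  refine ⟨k₀, fun k hk => ?_⟩
  have h := hk₀ k hk
  have h2 : (0 : ℝ) < 2 ^ k := by positivity
  rw [one_div, inv_pow, ← div_eq_mul_inv, pow_one, ← mul_div_assoc, ← add_div, ← mul_div_assoc,
    div_le_one h2] at h
  exact h

theorem exists_hasMorseConstant.{u} {l₁ l₂ : ℝ} (hl₁ : 0 < l₁) (hl₂ : 0 < l₂) :
    ∃ H : ℝ, 0 < H ∧ ∀ (Y : Type u) [MetricSpace Y] (δ : ℝ), 0 ≤ δ → IsGeodesicSpace Y →
      IsGromovHyperbolic Y δ → HasMorseConstant Y l₁ l₂ δ H := by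
  obtain ⟨k₀, hk₀⟩ := exists_pow_ge (l₂ / l₁)
  -- `k₀ + 6` takes the segment to the curve, one more `K` is the additive error, and the last term
  -- bounds `l₂ * (t - s₁)` in the second half.
  refine ⟨(k₀ + 7) + l₂ / l₁ * (2 * k₀ + 13), by positivity, ?_⟩
  intro Y _ δ hδ hG hY c a b K hab hK hδK hc
  obtain ⟨σ, hσ₀, hσ₁, hσ⟩ := hG (c a) (c b)
  have hℓ : 0 ≤ dist (c a) (c b) := dist_nonneg
  have hinf := infDist_segment_le hY hδ hl₁ hl₂ hk₀ hab hK hδK hc hℓ hσ₀ hσ₁ hσ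
  have hne : (c '' Set.Icc a b).Nonempty := ⟨c a, a, ⟨le_rfl, hab⟩, rfl⟩
  have hnear : ∀ τ ∈ Set.Icc 0 (dist (c a) (c b)), ∃ s ∈ Set.Icc a b,
      dist (σ τ) (c s) < (k₀ + 6) * K := by
    intro τ hτ
    obtain ⟨_, ⟨s, hs, rfl⟩, h⟩ := (Metric.infDist_lt_iff hne).1
      (lt_of_le_of_lt (hinf τ hτ) (show (k₀ + 5) * K < (k₀ + 6) * K by nlinarith))
    exact ⟨s, hs, h⟩
  have hsplit : ∀ τ ∈ Set.Icc 0 (dist (c a) (c b)),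
      dist (c a) (σ τ) = τ ∧ dist (c a) (σ τ) + dist (σ τ) (c b) = dist (c a) (c b) := by
    intro τ hτ
    have e₁ := hσ 0 ⟨le_rfl, hℓ⟩ τ hτ
    have e₂ := hσ τ hτ _ ⟨hℓ, le_rfl⟩
    rw [hσ₀, abs_of_nonpos (by linarith [hτ.1])] at e₁
    rw [hσ₁, abs_of_nonpos (by linarith [hτ.2])] at e₂
    exact ⟨by linarith, by linarith⟩
  have hq : 0 ≤ l₂ / l₁ * (2 * k₀ + 13) * K := by positivity
  constructor
  · intro p
    have hτ : gromovProd (c a) p (c b) ∈ Set.Icc 0 (dist (c a) (c b)) :=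
      ⟨gromovProd_nonneg _ _ _, by rw [gromovProd_comm]; exact gromovProd_le_dist_left _ _ _⟩
    obtain ⟨s, hs, hd⟩ := hnear _ hτ
    refine ⟨s, hs, ?_⟩
    have := hY.dist_le_of_mem_segment (p := p) (hsplit _ hτ).1 (hsplit _ hτ).2
    have := dist_triangle p (σ (gromovProd (c a) p (c b))) (c s)
    linarith
  · intro t ht
    have hσc : ContinuousOn σ (Set.Icc 0 (dist (c a) (c b))) := by
      have : LipschitzOnWith 1 σ (Set.Icc 0 (dist (c a) (c b))) :=
        LipschitzOnWith.of_dist_le_mul fun s hs t ht => by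
          rw [hσ s hs t ht, Real.dist_eq]; simp
      exact this.continuousOn
    set S₁ := c '' Set.Icc a t with hS₁
    set S₂ := c '' Set.Icc t b with hS₂
    have hne₁ : S₁.Nonempty := ⟨c a, a, ⟨le_rfl, ht.1⟩, rfl⟩
    have hne₂ : S₂.Nonempty := ⟨c b, b, ⟨ht.2, le_rfl⟩, rfl⟩
    -- Continuity is used along the segment, as `c` may jump: some point of it is equidistant from
    -- the parts of `c` before and after `t`. Both have a point near it, so those two parameters,
    -- and `t` between them, are close.
    obtain ⟨τ, hτ, hτe⟩ : ∃ τ ∈ Set.Icc 0 (dist (c a) (c b)),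
        Metric.infDist (σ τ) S₁ - Metric.infDist (σ τ) S₂ = 0 := by
      have hcont : ContinuousOn (fun τ => Metric.infDist (σ τ) S₁ - Metric.infDist (σ τ) S₂)
          (Set.Icc 0 (dist (c a) (c b))) :=
        ((Metric.continuous_infDist_pt S₁).comp_continuousOn hσc).sub
          ((Metric.continuous_infDist_pt S₂).comp_continuousOn hσc)
      refine intermediate_value_Icc hℓ hcont ⟨?_, ?_⟩
      · have : Metric.infDist (σ 0) S₁ = 0 :=
          Metric.infDist_zero_of_mem ⟨a, ⟨le_rfl, ht.1⟩, hσ₀.symm⟩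
        simp only [this]
        linarith [Metric.infDist_nonneg (x := σ 0) (s := S₂)]
      · have : Metric.infDist (σ (dist (c a) (c b))) S₂ = 0 :=
          Metric.infDist_zero_of_mem ⟨b, ⟨ht.2, le_rfl⟩, hσ₁.symm⟩
        simp only [this]
        linarith [Metric.infDist_nonneg (x := σ (dist (c a) (c b))) (s := S₁)]
    have hlt : Metric.infDist (σ τ) S₁ < (k₀ + 6) * K := by
      obtain ⟨s, hs, hd⟩ := hnear τ hτ
      rcases le_total s t with h | h
      · exact lt_of_le_of_lt (Metric.infDist_le_dist_of_mem ⟨s, ⟨hs.1, h⟩, rfl⟩) hd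
      · rw [sub_eq_zero.1 hτe]
        exact lt_of_le_of_lt (Metric.infDist_le_dist_of_mem ⟨s, ⟨h, hs.2⟩, rfl⟩) hd
    obtain ⟨_, ⟨s₁, hs₁, rfl⟩, hd₁⟩ := (Metric.infDist_lt_iff hne₁).1 hlt
    rw [sub_eq_zero.1 hτe] at hlt
    obtain ⟨_, ⟨s₂, hs₂, rfl⟩, hd₂⟩ := (Metric.infDist_lt_iff hne₂).1 hlt
    have hm₁ : s₁ ∈ Set.Icc a b := ⟨hs₁.1, hs₁.2.trans ht.2⟩
    have hm₂ : s₂ ∈ Set.Icc a b := ⟨ht.1.trans hs₂.1, hs₂.2⟩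
    have h₁ := (hc s₁ hm₁ s₂ hm₂).1
    have h₂ := (hc t ht s₁ hm₁).2
    have h₃ := dist_triangle_left (c s₁) (c s₂) (σ τ)
    rw [abs_of_nonpos (by linarith [hs₁.2, hs₂.1])] at h₁
    rw [abs_of_nonneg (by linarith [hs₁.2])] at h₂
    have h₄ : l₂ * (t - s₁) ≤ l₂ / l₁ * (2 * k₀ + 13) * K := by
      calc l₂ * (t - s₁) = l₂ / l₁ * (l₁ * (t - s₁)) := by field_simp
        _ ≤ l₂ / l₁ * ((2 * k₀ + 13) * K) := by
          have : l₁ * (t - s₁) ≤ l₁ * (s₂ - s₁) :=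
            mul_le_mul_of_nonneg_left (by linarith [hs₂.1]) hl₁.le
          exact mul_le_mul_of_nonneg_left (by linarith) (by positivity)
        _ = _ := by ring
    have h₅ : gromovProd (σ τ) (c a) (c b) = 0 := by
      have := (hsplit τ hτ).2
      unfold gromovProd
      rw [dist_comm (σ τ) (c a)]
      linarith
    have h₆ := gromovProd_le_add_dist (c t) (σ τ) (c a) (c b)
    have h₇ := dist_triangle_right (c t) (σ τ) (c s₁)
    linarith

end Morse

/-! ### From Gromov products at infinity to representing sequences. -/

section Boundary

variable {Y : Type*} [MetricSpace Y] {δ : ℝ} {o : Y}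

theorem IsCauchyGromov.exists_le {x : ℕ → Y} (hx : IsCauchyGromov o x) (b : ℝ) :
    ∃ N : ℕ, ∀ i ≥ N, ∀ n ≥ N, b ≤ gromovProd o (x i) (x n) := by
  obtain ⟨⟨a, c⟩, h⟩ := eventually_atTop.1 ((tendsto_atTop.1 hx) b)
  exact ⟨max a c, fun i hi n hn => h (i, n) (Prod.mk_le_mk.2 ⟨by omega, by omega⟩)⟩

theorem Represents.exists_le (hY : IsGromovHyperbolic Y δ) {x y : ℕ → Y} {η : GromovBoundary o}
    (hx : Represents x η) (hy : Represents y η) (b : ℝ) :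
    ∃ N : ℕ, ∀ i ≥ N, ∀ n ≥ N, b ≤ gromovProd o (x i) (y n) := by
  obtain ⟨hx, rfl⟩ := hx
  obtain ⟨hy, h⟩ := hy
  have hE := CauchyGromovSeq.equivalence_equiv hY o
  have hxy : CauchyGromovSeq.Equiv ⟨x, hx⟩ ⟨y, hy⟩ :=
    (hE.eqvGen_iff).1 (Quot.eqvGen_exact h.symm)
  unfold CauchyGromovSeq.Equiv at hxy
  rw [tendsto_atTop] at hxy
  obtain ⟨N₁, h₁⟩ := eventually_atTop.1 (hxy (b + δ))
  obtain ⟨N₂, h₂⟩ := hx.exists_le (b + δ)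
  refine ⟨max N₁ N₂, fun i hi n hn => ?_⟩
  have := hY.sub_le (h₂ i (by omega) n (by omega)) (h₁ n (by omega))
  linarith

/-- The liminf bounds the product only along some pairs arbitrarily far out. Since the tail of a
Cauchy-Gromov sequence has large products with itself, two uses of hyperbolicity spread the bound to
all late pairs; the `1` makes the inequality for the liminf strict. -/
theorem Represents.exists_le_of_boundaryProd_le (hY : IsGromovHyperbolic Y δ) (hδ : 0 ≤ δ)
    {x y : ℕ → Y} {ξ η : GromovBoundary o} (hx : Represents x ξ) (hy : Represents y η) {M : ℝ≥0}
    (hM : boundaryProd ξ η ≤ M) :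
    ∃ N : ℕ, ∀ i ≥ N, ∀ n ≥ N, gromovProd o (x i) (y n) ≤ M + 1 + 2 * δ := by
  obtain ⟨hx, hxξ⟩ := hx
  obtain ⟨hy, hyη⟩ := hy
  have hle : liminf (fun p : ℕ × ℕ => ENNReal.ofReal (gromovProd o (x p.1) (y p.2))) atTop ≤ M := by
    refine le_trans ?_ hM
    exact le_iSup_of_le ⟨x, hx⟩ (le_iSup_of_le ⟨y, hy⟩ (le_iSup_of_le hxξ (le_iSup_of_le hyη le_rfl)))
  have hlt : liminf (fun p : ℕ × ℕ => ENNReal.ofReal (gromovProd o (x p.1) (y p.2))) atTop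
      < ((M + 1 : ℝ≥0) : ℝ≥0∞) :=
    lt_of_le_of_lt hle (by exact_mod_cast lt_add_one M)
  have hfr := frequently_lt_of_liminf_lt (by isBoundedDefault) hlt
  obtain ⟨N₁, h₁⟩ := hx.exists_le (M + 1 + 2 * δ)
  obtain ⟨N₂, h₂⟩ := hy.exists_le (M + 1 + 2 * δ)
  refine ⟨max N₁ N₂, fun i hi n hn => ?_⟩
  obtain ⟨p, hp, hpM⟩ := (frequently_atTop.1 hfr) (max N₁ N₂, max N₁ N₂)
  obtain ⟨hp₁, hp₂⟩ := hp
  simp only at hp₁ hp₂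
  by_contra! h
  have := hY.sub_two_mul_le hδ (h₁ p.1 (by omega) i (by omega)) h.le (h₂ n (by omega) p.2 (by omega))
  have h' : gromovProd o (x p.1) (y p.2) < M + 1 := by
    have := (ENNReal.ofReal_lt_coe_iff (gromovProd_nonneg _ _ _)).1 hpM
    exact_mod_cast this
  linarith

end Boundary

/-! ### Separation of points lying near two lines. -/

section FourPoints

variable {Y : Type*} [MetricSpace Y] {δ : ℝ}

/-- Hyperbolicity at `P` bounds `(x | o)_P` or `(o | x')_P` by `E + δ`, and products at `P` and at
`o` add up to `dist o P`: a point near a line lies towards one of its ends. -/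
theorem IsGromovHyperbolic.sub_le_gromovProd_or (hY : IsGromovHyperbolic Y δ) {o P x x' : Y}
    {E : ℝ} (hP : gromovProd P x x' ≤ E) :
    dist o P - E - δ ≤ gromovProd o P x ∨ dist o P - E - δ ≤ gromovProd o P x' := by
  have h := (hY P x o x').trans hP
  have h₁ := gromovProd_add_gromovProd o P x
  have h₂ := gromovProd_add_gromovProd o P x'
  rcases min_le_iff.1 (sub_le_iff_le_add.1 h) with h' | h'
  · left; rw [gromovProd_comm] at h'; linarith
  · right; linarith

/-- The chain `x, P, Q, y` seen from `o` bounds `(P | Q)_o` by `B + E + 3 * δ`, because `(P | Q)_o`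
is at most either distance to `o`. -/
theorem IsGromovHyperbolic.dist_ge_of_gromovProd_le (hY : IsGromovHyperbolic Y δ) (hδ : 0 ≤ δ)
    {o P Q x y : Y} {E B : ℝ} (hE : 0 ≤ E) (hP : dist o P - E - δ ≤ gromovProd o P x)
    (hQ : dist o Q - E - δ ≤ gromovProd o Q y) (hB : gromovProd o x y ≤ B) :
    dist o P + dist o Q - 2 * B - 2 * E - 6 * δ ≤ dist P Q := by
  have h₁ := gromovProd_le_dist_left o P Q
  have h₂ := gromovProd_le_dist_left o Q P
  rw [gromovProd_comm] at h₂
  have := hY.sub_two_mul_le hδ (p := o) (x := x) (y := P) (z := Q) (w := y)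
    (A := gromovProd o P Q - E - δ) (by rw [gromovProd_comm o x P]; linarith) (by linarith) (by linarith)
  linarith [dist_eq_gromovProd o P Q]

/-- Points near two lines whose endpoints have small Gromov products are far apart if they are
far from the base-point. -/
theorem IsGromovHyperbolic.le_dist_of_near_lines (hY : IsGromovHyperbolic Y δ) (hδ : 0 ≤ δ)
    {o P Q x x' y y' : Y} {E B : ℝ} (hP : gromovProd P x x' ≤ E) (hQ : gromovProd Q y y' ≤ E)
    (h₁ : gromovProd o x y ≤ B) (h₂ : gromovProd o x y' ≤ B) (h₃ : gromovProd o x' y ≤ B)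
    (h₄ : gromovProd o x' y' ≤ B) :
    dist o P + dist o Q - 2 * B - 2 * E - 6 * δ ≤ dist P Q := by
  have hE : 0 ≤ E := (gromovProd_nonneg _ _ _).trans hP
  rcases hY.sub_le_gromovProd_or (o := o) hP with hP | hP <;>
    rcases hY.sub_le_gromovProd_or (o := o) hQ with hQ | hQ
  · exact hY.dist_ge_of_gromovProd_le hδ hE hP hQ h₁
  · exact hY.dist_ge_of_gromovProd_le hδ hE hP hQ h₂
  · exact hY.dist_ge_of_gromovProd_le hδ hE hP hQ h₃
  · exact hY.dist_ge_of_gromovProd_le hδ hE hP hQ h₄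

/-- A geodesic passes near every point at which the Gromov product of two of its points
is small. -/
theorem IsGromovHyperbolic.exists_dist_le_of_isometry (hY : IsGromovHyperbolic Y δ) {γ : ℝ → Y}
    (hγ : Isometry γ) (p : Y) (n : ℕ) :
    ∃ τ, dist p (γ τ) ≤ gromovProd p (γ (-n)) (γ n) + 2 * δ := by
  set r := gromovProd (γ (-n)) p (γ n) with hr
  have h₀ : 0 ≤ r := gromovProd_nonneg _ _ _
  have hd : dist (γ (-n)) (γ n) = 2 * n := by
    rw [hγ.dist_eq, Real.dist_eq, abs_of_nonpos (by linarith [Nat.cast_nonneg (α := ℝ) n])]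
    ring
  have h₁ : r ≤ 2 * n := by
    rw [← hd, hr, gromovProd_comm]
    exact gromovProd_le_dist_left _ _ _
  have e₁ : dist (γ (-n)) (γ (-n + r)) = r := by
    rw [hγ.dist_eq, Real.dist_eq, abs_of_nonpos (by linarith)]
    ring
  have e₂ : dist (γ (-n + r)) (γ n) = 2 * n - r := by
    rw [hγ.dist_eq, Real.dist_eq, abs_of_nonpos (by linarith)]
    ring
  exact ⟨-n + r, hY.dist_le_of_mem_segment e₁ (by rw [e₁, e₂, hd]; ring)⟩

theorem Isometry.gromovProd_eq_zero {γ : ℝ → Y} (hγ : Isometry γ) {τ : ℝ} {n : ℕ}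
    (hn : |τ| ≤ n) : gromovProd (γ τ) (γ (-n)) (γ n) = 0 := by
  obtain ⟨h₁, h₂⟩ := abs_le.1 hn
  unfold gromovProd
  rw [hγ.dist_eq, hγ.dist_eq, hγ.dist_eq, Real.dist_eq, Real.dist_eq, Real.dist_eq,
    abs_of_nonneg (by linarith), abs_of_nonpos (by linarith), abs_of_nonpos (by linarith)]
  ring

end FourPoints

/-! ### A sublinear geodesic against the geodesic with the same ends. -/

section SublinearGeodesic

variable {Y : Type*} [MetricSpace Y] {δ : ℝ} {lam : ℝ × ℝ} {v : ℝ≥0 → ℝ} {c γ : ℝ → Y}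
  {H ε : ℝ} {R : ℝ≥0}

/-- From the scale `R` on, the additive error `v` and the hyperbolicity constant are small compared
to the scale. -/
structure IsLargeScale (lam : ℝ × ℝ) (v : ℝ≥0 → ℝ) (δ H ε : ℝ) (R : ℝ≥0) : Prop where
  fst_pos : 0 < lam.1
  snd_pos : 0 < lam.2
  delta_nonneg : 0 ≤ δ
  morse_pos : 0 < H
  eps_pos : 0 < ε
  one_le : 1 ≤ R
  one_le_error : ∀ r, 1 ≤ v r
  mono : Monotone v
  error_le : ∀ r, R ≤ r → v r ≤ ε * r
  delta_le : δ ≤ ε * R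
  eps_le : (1 + H) * ε ≤ lam.1 / 64

theorem IsSublinearGeodesic.isQuasiGeodesicOn (hc : IsSublinearGeodesic lam v c) (hv : Monotone v)
    {T : ℝ≥0} {K : ℝ} (hK : v T ≤ K) : IsQuasiGeodesicOn lam.1 lam.2 K c (-T) T := by
  intro s hs t ht
  have hle : ∀ r ∈ Set.Icc (-(T : ℝ)) T, nndist (0 : ℝ) r ≤ T := fun r hr => by
    rw [← NNReal.coe_le_coe, coe_nndist, Real.dist_eq, zero_sub, abs_neg]
    exact abs_le.2 hr
  have := (hv (max_le (hle s hs) (hle t ht))).trans hK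
  have h := hc s t
  rw [Real.dist_eq] at h
  exact ⟨by linarith [h.1], by linarith [h.2]⟩

theorem IsSublinearGeodesic.comp_neg (hc : IsSublinearGeodesic lam v c) :
    IsSublinearGeodesic lam v fun t => c (-t) := by
  intro s t
  have h := hc (-s) (-t)
  rwa [dist_neg_neg, show nndist (0 : ℝ) (-s) = nndist 0 s by simp [nndist_eq_nnnorm],
    show nndist (0 : ℝ) (-t) = nndist 0 t by simp [nndist_eq_nnnorm]] at h

theorem IsLargeScale.bounds (hS : IsLargeScale lam v δ H ε R) {T : ℝ≥0} (hT : R ≤ T) :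
    v T ≤ ε * T ∧ δ ≤ ε * T ∧ 1 ≤ (T : ℝ) ∧ 0 < v T + δ := by
  have h₁ : (R : ℝ) ≤ T := hT
  have h₂ : (1 : ℝ) ≤ R := hS.one_le
  refine ⟨hS.error_le T hT, hS.delta_le.trans ?_, h₂.trans h₁, ?_⟩
  · exact mul_le_mul_of_nonneg_left h₁ hS.eps_pos.le
  · linarith [hS.one_le_error T, hS.delta_nonneg]

/-- The Morse property and the linear growth of a sublinear geodesic on `[-T, T]`. -/
theorem IsLargeScale.morse_le (hS : IsLargeScale lam v δ H ε R) {T : ℝ≥0} (hT : R ≤ T) :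
    H * (v T + δ) + (v T + δ) ≤ lam.1 / 32 * T := by
  obtain ⟨h₁, h₂, h₃, -⟩ := hS.bounds hT
  have h₄ := mul_le_mul_of_nonneg_right hS.eps_le (show (0 : ℝ) ≤ T by positivity)
  have h₅ := mul_le_mul_of_nonneg_left (show v T + δ ≤ 2 * (ε * T) by linarith)
    (show 0 ≤ 1 + H by linarith [hS.morse_pos])
  linarith

/-- By the Morse lemma on `[0, 2 * T]`, the product of `c 0` and `c (2 * T)` at `c T` is small, so
the product at `c 0` is nearly `dist (c 0) (c T)`. -/
theorem IsLargeScale.le_gromovProd_two_mul (hS : IsLargeScale lam v δ H ε R)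
    (hM : HasMorseConstant Y lam.1 lam.2 δ H) (hc : IsSublinearGeodesic lam v c) {T : ℝ≥0}
    (hT : R ≤ T) : lam.1 / 2 * T ≤ gromovProd (c 0) (c T) (c (2 * T)) := by
  have hT₂ : R ≤ 2 * T := hT.trans (by rw [two_mul]; exact le_self_add)
  obtain ⟨-, -, hT₁, hK⟩ := hS.bounds hT₂
  have hle := hS.morse_le hT₂
  push_cast at hT₁ hle
  have hqg : IsQuasiGeodesicOn lam.1 lam.2 (v (2 * T) + δ) c 0 (2 * T) := by
    have h := hc.isQuasiGeodesicOn hS.mono (T := 2 * T) (K := v (2 * T) + δ)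
      (by linarith [hS.delta_nonneg])
    push_cast at h
    exact fun s hs t ht => h s ⟨by linarith [hs.1], hs.2⟩ t ⟨by linarith [ht.1], ht.2⟩
  have hmT : (T : ℝ) ∈ Set.Icc (0 : ℝ) (2 * T) := ⟨by linarith, by linarith⟩
  have h₁ := (hM c 0 (2 * T) _ (by linarith) hK (by linarith [hS.one_le_error (2 * T)]) hqg).2 T hmT
  have h₂ := (hqg 0 ⟨le_rfl, by linarith⟩ T hmT).1
  rw [zero_sub, abs_neg, abs_of_nonneg hmT.1] at h₂
  have h₃ := gromovProd_add_gromovProd (c 0) (c T) (c (2 * T))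
  have h₄ := mul_pos hS.fst_pos (show (0 : ℝ) < T by linarith)
  linarith

/-- The losses do not accumulate: the induction hypothesis at scale `2 * T` already gives `lam.1 / 2
* T`, so every step loses a single `δ` from `lam.1 / 2 * T`. -/
theorem IsLargeScale.le_gromovProd_two_pow_mul (hS : IsLargeScale lam v δ H ε R)
    (hY : IsGromovHyperbolic Y δ) (hM : HasMorseConstant Y lam.1 lam.2 δ H)
    (hc : IsSublinearGeodesic lam v c) (k : ℕ) :
    ∀ T : ℝ≥0, R ≤ T → lam.1 / 4 * T ≤ gromovProd (c 0) (c T) (c (2 ^ k * T)) := by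
  induction k with
  | zero =>
    intro T hT
    obtain ⟨-, -, hT₁, -⟩ := hS.bounds hT
    have h₁ := gromovProd_le_dist_left (c 0) (c T) (c (2 * T))
    have h₂ := hS.le_gromovProd_two_mul hM hc hT
    have h₃ := dist_sub_dist_le_gromovProd (c 0) (c T) (c T)
    have h₄ := mul_pos hS.fst_pos (show (0 : ℝ) < T by linarith)
    rw [dist_self] at h₃
    rw [pow_zero, one_mul]
    linarith
  | succ k ih =>
    intro T hT
    have hT₂ : R ≤ 2 * T := hT.trans (by rw [two_mul]; exact le_self_add)
    obtain ⟨-, -, hT₁, -⟩ := hS.bounds hT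
    have h₁ := hS.le_gromovProd_two_mul hM hc hT
    have h₂ := ih (2 * T) hT₂
    have h₃ := hS.morse_le hT
    have h₄ := mul_pos hS.fst_pos (show (0 : ℝ) < T by linarith)
    have h₅ : 0 ≤ H * (v T + δ) :=
      mul_nonneg hS.morse_pos.le (by linarith [hS.one_le_error T, hS.delta_nonneg])
    push_cast at h₂
    rw [← mul_assoc (2 ^ k), ← pow_succ] at h₂
    have := hY.sub_le (A := lam.1 / 2 * T) h₁ (le_trans (by linarith) h₂)
    linarith [hS.one_le_error T]

theorem IsLargeScale.eventually_le_gromovProd (hS : IsLargeScale lam v δ H ε R)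
    (hY : IsGromovHyperbolic Y δ) (hM : HasMorseConstant Y lam.1 lam.2 δ H)
    (hc : IsSublinearGeodesic lam v c) {o : Y} {x : ℕ → Y}
    (hx : ∀ b : ℝ, ∃ N : ℕ, ∀ i ≥ N, ∀ n ≥ N, b ≤ gromovProd o (c (i : ℕ)) (x n))
    {T : ℕ} (hT : R ≤ T) : ∀ᶠ n in atTop, lam.1 / 8 * T ≤ gromovProd (c 0) (c T) (x n) := by
  obtain ⟨N, hN⟩ := hx (lam.1 / 4 * T + dist o (c 0))
  filter_upwards [eventually_ge_atTop N] with n hn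
  obtain ⟨-, -, hT₁, -⟩ := hS.bounds hT
  have hT' : 1 ≤ T := by exact_mod_cast hT₁
  -- The parameter `2 ^ N * T` is past `N` and is also reached from `T` by doubling.
  have h₁ := hN (2 ^ N * T) (Nat.lt_two_pow_self.le.trans (Nat.le_mul_of_pos_right _ hT')) n hn
  have h₂ := gromovProd_le_add_dist o (c 0) (c ((2 ^ N * T : ℕ) : ℝ)) (x n)
  have h₃ := hS.le_gromovProd_two_pow_mul hY hM hc N T hT
  have h₄ := hS.morse_le hT
  have h₅ : 0 ≤ H * (v T + δ) :=
    mul_nonneg hS.morse_pos.le (by linarith [hS.one_le_error T, hS.delta_nonneg])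
  have h₆ := mul_pos hS.fst_pos (show (0 : ℝ) < T by positivity)
  push_cast at h₁ h₂ h₃ h₄
  have h₇ : lam.1 / 4 * T ≤ gromovProd (c 0) (c (2 ^ N * T)) (x n) := by linarith
  have := hY.sub_le h₃ h₇
  linarith [hS.one_le_error T]

/-- The curves `c` and `γ` converge to the same points at infinity at both ends. -/
def HasSameEnds (o : Y) (c γ : ℝ → Y) : Prop :=
  (∀ b : ℝ, ∃ N : ℕ, ∀ i ≥ N, ∀ n ≥ N, b ≤ gromovProd o (c (i : ℕ)) (γ (n : ℕ))) ∧
    ∀ b : ℝ, ∃ N : ℕ, ∀ i ≥ N, ∀ n ≥ N, b ≤ gromovProd o (c (-(i : ℕ))) (γ (-(n : ℕ)))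

theorem IsLargeScale.eventually_le_gromovProd_of_dist_le (hS : IsLargeScale lam v δ H ε R)
    (hY : IsGromovHyperbolic Y δ) (hM : HasMorseConstant Y lam.1 lam.2 δ H)
    (hc : IsSublinearGeodesic lam v c) {o : Y} (hcγ : HasSameEnds o c γ) {T : ℕ} (hT : R ≤ T)
    {a : Y} (ha : dist a (c 0) ≤ lam.1 / 16 * T) :
    ∀ᶠ n : ℕ in atTop, lam.1 / 16 * T ≤ gromovProd a (c T) (γ n) ∧
      lam.1 / 16 * T ≤ gromovProd a (c (-T)) (γ (-n)) := by
  have h₁ := hS.eventually_le_gromovProd hY hM hc hcγ.1 hT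
  have h₂ := hS.eventually_le_gromovProd hY hM hc.comp_neg (x := fun n => γ (-n)) hcγ.2 hT
  filter_upwards [h₁, h₂] with n h₁ h₂
  have e₁ := gromovProd_le_add_dist (c 0) a (c T) (γ n)
  have e₂ := gromovProd_le_add_dist (c 0) a (c (-T)) (γ (-n))
  rw [neg_zero] at h₂
  rw [dist_comm (c 0)] at e₁ e₂
  exact ⟨by linarith, by linarith⟩

/-- The points of the geodesic are close to the sublinear geodesic with the same endpoints. -/
theorem IsLargeScale.exists_dist_le (hS : IsLargeScale lam v δ H ε R)
    (hY : IsGromovHyperbolic Y δ) (hM : HasMorseConstant Y lam.1 lam.2 δ H)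
    (hc : IsSublinearGeodesic lam v c) (hγ : Isometry γ) {o : Y} (hcγ : HasSameEnds o c γ)
    {T : ℕ} (hT : R ≤ T) {τ : ℝ} (hτ : dist (γ τ) (c 0) ≤ lam.1 / 16 * T) :
    ∃ t, dist (γ τ) (c t) ≤ 4 * δ + H * (v T + δ) := by
  obtain ⟨n, ⟨h₁, h₂⟩, hn⟩ := ((hS.eventually_le_gromovProd_of_dist_le hY hM hc hcγ hT hτ).and
    (eventually_ge_atTop ⌈|τ|⌉₊)).exists
  have hz := hγ.gromovProd_eq_zero (Nat.ceil_le.1 hn)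
  obtain ⟨-, hδT, hT₁, hK⟩ := hS.bounds hT
  have hle := hS.morse_le hT
  have hHK := mul_pos hS.morse_pos hK
  have hv := hS.one_le_error T
  have hδ := hS.delta_nonneg
  push_cast at hT₁ hle
  have hqg := hc.isQuasiGeodesicOn hS.mono (T := T) (K := v T + δ) (by linarith)
  push_cast at hqg
  obtain ⟨t, -, ht⟩ := (hM c _ _ _ (by linarith) hK (by linarith) hqg).1 (γ τ)
  refine ⟨t, ?_⟩
  -- In the chain `γ (-n), c (-T), c T, γ n` seen from `γ τ`, the end points have product zero and
  -- the outer links are large, so the middle link must be small.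
  have : gromovProd (γ τ) (c (-T)) (c T) ≤ 2 * δ := by
    by_contra! hlt
    have := hY.sub_two_mul_le hδ
      (A := min (lam.1 / 16 * T) (gromovProd (γ τ) (c (-T)) (c T)))
      (by rw [gromovProd_comm _ (γ (-n))]; exact (min_le_left _ _).trans h₂) (min_le_right _ _)
      ((min_le_left _ _).trans h₁)
    rw [hz] at this
    rcases min_le_iff.1 (sub_nonpos.1 this) with h | h
    · linarith
    · linarith
  linarith

/-- The points of a sublinear geodesic are close to the geodesic with the same endpoints. -/
theorem IsLargeScale.eventually_gromovProd_le (hS : IsLargeScale lam v δ H ε R)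
    (hY : IsGromovHyperbolic Y δ) (hM : HasMorseConstant Y lam.1 lam.2 δ H)
    (hc : IsSublinearGeodesic lam v c) {o : Y} (hcγ : HasSameEnds o c γ)
    {T : ℕ} (hT : R ≤ T) {s : ℝ} (hs : |s| ≤ T) (hs' : lam.2 * |s| ≤ lam.1 / 32 * T) :
    ∀ᶠ n : ℕ in atTop, gromovProd (c s) (γ (-n)) (γ n) ≤ H * (v T + δ) + 2 * δ := by
  obtain ⟨-, hδT, hT₁, hK⟩ := hS.bounds hT
  have hle := hS.morse_le hT
  have hHK := mul_pos hS.morse_pos hK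
  have hv := hS.one_le_error T
  have hδ := hS.delta_nonneg
  push_cast at hT₁ hle
  have hqg := hc.isQuasiGeodesicOn hS.mono (T := T) (K := v T + δ) (by linarith)
  push_cast at hqg
  have hsm := abs_le.1 hs
  have hmorse := (hM c _ _ _ (by linarith) hK (by linarith) hqg).2 s hsm
  have hd : dist (c s) (c 0) ≤ lam.1 / 16 * T := by
    have := (hqg s hsm 0 ⟨by linarith, by linarith⟩).2
    rw [sub_zero] at this
    linarith
  filter_upwards [hS.eventually_le_gromovProd_of_dist_le hY hM hc hcγ hT hd] with n ⟨h₁, h₂⟩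
  by_contra! hlt
  have h₃ : H * (v T + δ) + (v T + δ) + δ < lam.1 / 16 * T := by
    have := mul_pos hS.fst_pos (show (0 : ℝ) < T by linarith)
    linarith
  -- The chain is now `c (-T), γ (-n), γ n, c T`, seen from `c s`; the Morse lemma bounds the
  -- product of its ends.
  have := hY.sub_two_mul_le hδ
    (A := min (lam.1 / 16 * T) (gromovProd (c s) (γ (-n)) (γ n)))
    ((min_le_left _ _).trans h₂) (min_le_right _ _)
    (by rw [gromovProd_comm _ (γ n)]; exact (min_le_left _ _).trans h₁)
  rcases min_le_iff.1 ((sub_le_iff_le_add.1 this).trans (add_le_add_left hmorse _)) with h | h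
  · linarith
  · linarith

end SublinearGeodesic

/-! ### The distance between curves as an infimum. -/

section CurveDist

variable {Y : Type*} [MetricSpace Y]

theorem curveDist_le (c c' : ℝ → Y) (s t : ℝ) : curveDist c c' ≤ dist (c s) (c' t) :=
  ciInf_le (f := fun p : ℝ × ℝ => dist (c p.1) (c' p.2))
    ⟨0, by rintro _ ⟨p, rfl⟩; exact dist_nonneg⟩ (s, t)

theorem le_curveDist {c c' : ℝ → Y} {d : ℝ} (h : ∀ s t, d ≤ dist (c s) (c' t)) :
    d ≤ curveDist c c' :=
  le_ciInf fun p => h p.1 p.2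

theorem exists_dist_lt_curveDist_add_one (c c' : ℝ → Y) :
    ∃ s t, dist (c s) (c' t) < curveDist c c' + 1 := by
  obtain ⟨p, hp⟩ := exists_lt_of_ciInf_lt (lt_add_one (curveDist c c'))
  exact ⟨p.1, p.2, hp⟩

end CurveDist

/-! ### Comparison of the two distances at scales comparable to `M`. -/

section Comparison

variable {Y : Type*} [MetricSpace Y] {δ : ℝ} {lam : ℝ × ℝ} {v : ℝ≥0 → ℝ}
  {H ε L D : ℝ} {R A C M : ℝ≥0} {o : Y}

/-- A scale from which on the distance between two sublinear geodesics can be compared to the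
distance between the geodesics with the same endpoints. -/
structure IsComparisonScale (lam : ℝ × ℝ) (v : ℝ≥0 → ℝ) (δ H ε : ℝ) (R : ℝ≥0) (L : ℝ) (A C : ℝ≥0)
    (D : ℝ) : Prop extends IsLargeScale lam v δ H ε R where
  one_lt : 1 < L
  one_le_A : 1 ≤ A
  one_le_C : 1 ≤ C
  snd_le : 32 * lam.2 ≤ lam.1 * A
  le_A : 32 ≤ lam.1 * A
  le_C : 16 * (8 * L + 12) ≤ lam.1 * C
  eps_le_one : 64 * ((1 + H) * ε * A * L) ≤ 1
  eps_le_fst : 64 * ((1 + H) * ε * A * L) ≤ lam.1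
  doubling : ∀ r, R ≤ r → v (2 * (A * (C * r))) ≤ D * v r

theorem le_natCeil_and_le {x : ℝ≥0} (hx : 1 ≤ x) :
    x ≤ (⌈x⌉₊ : ℝ≥0) ∧ (⌈x⌉₊ : ℝ≥0) ≤ 2 * x := by
  refine ⟨Nat.le_ceil x, (Nat.ceil_lt_add_one zero_le).le.trans ?_⟩
  rw [two_mul]
  gcongr

theorem IsComparisonScale.delta_le_div (hS : IsComparisonScale lam v δ H ε R L A C D)
    (hM : R ≤ M) : 64 * δ ≤ M := by
  obtain ⟨-, h₁, h₂, -⟩ := hS.bounds hM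
  have hA : (1 : ℝ) ≤ A := hS.one_le_A
  have hε := hS.eps_pos
  have h₃ : ε ≤ (1 + H) * ε * A * L := by
    calc ε = 1 * ε * 1 * 1 := by ring
      _ ≤ (1 + H) * ε * A * L := by
        have := hS.morse_pos
        have := hS.one_lt
        gcongr
        linarith
  have := mul_le_mul_of_nonneg_right (show ε ≤ 1 / 64 by linarith [hS.eps_le_one])
    (show (0 : ℝ) ≤ M by positivity)
  linarith

/-- The Morse constant at the scale `2 * A * m` is small compared to `m`. -/
theorem IsComparisonScale.morse_le_mul (hS : IsComparisonScale lam v δ H ε R L A C D)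
    {T m : ℝ≥0} (hT : R ≤ T) (hTm : T ≤ 2 * (A * m)) :
    16 * (L * ((1 + H) * (v T + δ))) ≤ m ∧ 16 * ((1 + H) * (v T + δ)) ≤ lam.1 * m := by
  obtain ⟨h₁, h₂, -, hK⟩ := hS.bounds hT
  have hε := hS.eps_pos
  have hH := hS.morse_pos
  have hL := hS.one_lt
  have hTm' : (T : ℝ) ≤ 2 * (A * m) := by exact_mod_cast hTm
  have h₃ : v T + δ ≤ 4 * (ε * (A * m)) := by
    have := mul_le_mul_of_nonneg_left hTm' hε.le
    linarith
  have h₄ := mul_le_mul_of_nonneg_left h₃ (show 0 ≤ 1 + H by linarith)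
  have h₅ := mul_le_mul_of_nonneg_left h₄ (show 0 ≤ L by linarith)
  have h₆ : (1 + H) * (v T + δ) ≤ L * ((1 + H) * (v T + δ)) :=
    le_mul_of_one_le_left (mul_nonneg (by linarith) hK.le) hL.le
  have h₇ := mul_le_mul_of_nonneg_right hS.eps_le_one (show (0 : ℝ) ≤ m by positivity)
  have h₈ := mul_le_mul_of_nonneg_right hS.eps_le_fst (show (0 : ℝ) ≤ m by positivity)
  constructor <;> linarith

/-- A sublinear geodesic whose parameter `0` is nearly closest to the base-point starts at most
as far from the base-point as the geodesic with the same endpoints, up to a multiplicative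
constant. -/
theorem IsComparisonScale.dist_zero_le (hS : IsComparisonScale lam v δ H ε R L A C D)
    (hY : IsGromovHyperbolic Y δ) (hMorse : HasMorseConstant Y lam.1 lam.2 δ H) (hM : R ≤ M)
    {c γ : ℝ → Y} (hc : IsSublinearGeodesic lam v c) (hγ : Isometry γ) (hcγ : HasSameEnds o c γ)
    (hB : ∀ᶠ n : ℕ in atTop, gromovProd o (γ (-n)) (γ n) ≤ 2 * M)
    (hprox : dist o (c 0) ≤ L * ⨅ t : ℝ, dist o (c t)) : dist o (c 0) ≤ 8 * L * M := by
  by_contra! hlt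
  obtain ⟨n, hn⟩ := hB.exists
  obtain ⟨τ, hτ⟩ := hY.exists_dist_le_of_isometry hγ o n
  have hδM := hS.delta_le_div hM
  have hL := hS.one_lt
  have hM₁ : (1 : ℝ) ≤ M := hS.one_le.trans hM
  have hLM : (M : ℝ) ≤ L * M := le_mul_of_one_le_left (by positivity) hL.le
  have hMρ : M ≤ nndist o (c 0) := by
    rw [← NNReal.coe_le_coe, coe_nndist]; linarith
  have hAρ : nndist o (c 0) ≤ A * nndist o (c 0) := le_mul_of_one_le_left zero_le hS.one_le_A
  -- The scale is tied to `dist o (c 0)`, not yet controlled by `M`. The Morse error at this scale,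
  -- even multiplied by `L`, is at most a sixteenth of that distance.
  obtain ⟨hT₁, hT₂⟩ := le_natCeil_and_le
    (show 1 ≤ A * nndist o (c 0) from (hS.one_le.trans hM).trans (hMρ.trans hAρ))
  set T : ℕ := ⌈A * nndist o (c 0)⌉₊
  have hT : R ≤ T := hM.trans (hMρ.trans (hAρ.trans hT₁))
  have hT₁' : A * dist o (c 0) ≤ T := by exact_mod_cast hT₁
  obtain ⟨h₁, -⟩ := hS.morse_le_mul hT hT₂
  rw [coe_nndist] at h₁
  have hd : dist (γ τ) (c 0) ≤ lam.1 / 16 * T := by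
    have e₁ := dist_triangle_left (γ τ) (c 0) o
    have e₂ := mul_le_mul_of_nonneg_left hT₁' hS.fst_pos.le
    have e₃ := mul_le_mul_of_nonneg_right hS.le_A (dist_nonneg (x := o) (y := c 0))
    linarith
  obtain ⟨t, ht⟩ := hS.exists_dist_le hY hMorse hc hγ hcγ hT hd
  have hle : dist o (c 0) ≤ L * dist o (c t) := by
    refine hprox.trans (mul_le_mul_of_nonneg_left ?_ (by linarith))
    exact ciInf_le ⟨0, by rintro _ ⟨p, rfl⟩; exact dist_nonneg⟩ t
  have hK : 0 < v T + δ := (hS.bounds hT).2.2.2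
  have e₁ := dist_triangle o (γ τ) (c t)
  have e₂ : L * dist o (c t) ≤ L * (3 * M + (1 + H) * (v T + δ)) := by
    gcongr
    linarith
  linarith

theorem IsComparisonScale.curveDist_le_six_mul (hS : IsComparisonScale lam v δ H ε R L A C D)
    (hY : IsGromovHyperbolic Y δ) (hM : R ≤ M) {γ : Fin 2 → ℝ → Y} (hγ : ∀ i, Isometry (γ i))
    (hB : ∀ i, ∀ᶠ n : ℕ in atTop, gromovProd o (γ i (-n)) (γ i n) ≤ 2 * M) :
    curveDist (γ 0) (γ 1) ≤ 6 * M := by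
  have hδM := hS.delta_le_div hM
  have hδ := hS.delta_nonneg
  obtain ⟨n, hn₀, hn₁⟩ := ((hB 0).and (hB 1)).exists
  obtain ⟨τ₀, h₀⟩ := hY.exists_dist_le_of_isometry (hγ 0) o n
  obtain ⟨τ₁, h₁⟩ := hY.exists_dist_le_of_isometry (hγ 1) o n
  have := curveDist_le (γ 0) (γ 1) τ₀ τ₁
  have := dist_triangle_left (γ 0 τ₀) (γ 1 τ₁) o
  linarith

/-- The Gromov products of the points of `γ 0` and `γ 1` near infinity are at most `B`. -/
def CrossProdLE (o : Y) (γ : Fin 2 → ℝ → Y) (B : ℝ) : Prop :=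
  ∀ᶠ n : ℕ in atTop, gromovProd o (γ 0 (-n)) (γ 1 (-n)) ≤ B ∧
    gromovProd o (γ 0 (-n)) (γ 1 n) ≤ B ∧ gromovProd o (γ 0 n) (γ 1 (-n)) ≤ B ∧
    gromovProd o (γ 0 n) (γ 1 n) ≤ B

/-- A nearly minimising pair on the geodesics is less than `6 * M + 1` apart, hence within `12 * M`
of `o` by `IsGromovHyperbolic.le_dist_of_near_lines`. At the scale `A * (C * M)` both points are
then close enough to `c i 0` for `IsLargeScale.exists_dist_le`. -/
theorem IsComparisonScale.curveDist_sublinear_le (hS : IsComparisonScale lam v δ H ε R L A C D)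
    (hY : IsGromovHyperbolic Y δ) (hMorse : HasMorseConstant Y lam.1 lam.2 δ H) (hM : R ≤ M)
    {c γ : Fin 2 → ℝ → Y} (hc : ∀ i, IsSublinearGeodesic lam v (c i)) (hγ : ∀ i, Isometry (γ i))
    (hcγ : ∀ i, HasSameEnds o (c i) (γ i))
    (hB : ∀ i, ∀ᶠ n : ℕ in atTop, gromovProd o (γ i (-n)) (γ i n) ≤ 2 * M)
    (hcross : CrossProdLE o γ (2 * M)) (hzero : ∀ i, dist o (c i 0) ≤ 8 * L * M) :
    curveDist (c 0) (c 1)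
      ≤ curveDist (γ 0) (γ 1) + 1 + 2 * (4 * δ + H * (D * v M + δ)) := by
  have hδM := hS.delta_le_div hM
  have hδ := hS.delta_nonneg
  have hM₁ : (1 : ℝ) ≤ M := hS.one_le.trans hM
  have hsix := hS.curveDist_le_six_mul hY hM hγ hB
  obtain ⟨τ₀, τ₁, hτ⟩ := exists_dist_lt_curveDist_add_one (γ 0) (γ 1)
  obtain ⟨n, ⟨h₁, h₂, h₃, h₄⟩, hn⟩ :=
    (hcross.and (eventually_ge_atTop (max ⌈|τ₀|⌉₊ ⌈|τ₁|⌉₊))).exists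
  have hfar := hY.le_dist_of_near_lines hδ (E := 0)
    ((hγ 0).gromovProd_eq_zero (Nat.ceil_le.1 ((le_max_left _ _).trans hn))).le
    ((hγ 1).gromovProd_eq_zero (Nat.ceil_le.1 ((le_max_right _ _).trans hn))).le h₁ h₂ h₃ h₄
  have hMA : M ≤ A * (C * M) :=
    (le_mul_of_one_le_left zero_le hS.one_le_C).trans
      (le_mul_of_one_le_left zero_le hS.one_le_A)
  obtain ⟨hT₁, hT₂⟩ := le_natCeil_and_le ((hS.one_le.trans hM).trans hMA)
  set T : ℕ := ⌈A * (C * M)⌉₊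
  have hT : R ≤ T := hM.trans (hMA.trans hT₁)
  have hCT : (C : ℝ) * M ≤ T := by
    exact_mod_cast (le_mul_of_one_le_left zero_le hS.one_le_A).trans hT₁
  have hlarge : 12 * (M : ℝ) + 8 * L * M ≤ lam.1 / 16 * T := by
    have e₁ := mul_le_mul_of_nonneg_left hCT hS.fst_pos.le
    have e₂ := mul_le_mul_of_nonneg_right hS.le_C (show (0 : ℝ) ≤ M by positivity)
    linarith
  have hd₀ : dist (γ 0 τ₀) (c 0 0) ≤ lam.1 / 16 * T := by
    have := dist_triangle_left (γ 0 τ₀) (c 0 0) o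
    linarith [hzero 0, dist_nonneg (x := o) (y := γ 1 τ₁)]
  have hd₁ : dist (γ 1 τ₁) (c 1 0) ≤ lam.1 / 16 * T := by
    have := dist_triangle_left (γ 1 τ₁) (c 1 0) o
    linarith [hzero 1, dist_nonneg (x := o) (y := γ 0 τ₀)]
  obtain ⟨t₀, ht₀⟩ := hS.exists_dist_le hY hMorse (hc 0) (hγ 0) (hcγ 0) hT hd₀
  obtain ⟨t₁, ht₁⟩ := hS.exists_dist_le hY hMorse (hc 1) (hγ 1) (hcγ 1) hT hd₁
  have hvT : H * (v T + δ) ≤ H * (D * v M + δ) :=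
    mul_le_mul_of_nonneg_left (by linarith [hS.mono hT₂, hS.doubling M hM]) hS.morse_pos.le
  have := curveDist_le (c 0) (c 1) t₀ t₁
  have := dist_triangle4_left (γ 0 τ₀) (γ 1 τ₁) (c 0 t₀) (c 1 t₁)
  linarith

/-- If both parameters are at most `C * M`, the points are near the geodesics with error controlled
by `v M + δ`. Otherwise one point is so far from `o` that the two are further apart than `6 * M`,
which already bounds the distance of the geodesics. -/
theorem IsComparisonScale.le_curveDist_sublinear (hS : IsComparisonScale lam v δ H ε R L A C D)
    (hY : IsGromovHyperbolic Y δ) (hMorse : HasMorseConstant Y lam.1 lam.2 δ H) (hM : R ≤ M)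
    {c γ : Fin 2 → ℝ → Y} (hc : ∀ i, IsSublinearGeodesic lam v (c i)) (hγ : ∀ i, Isometry (γ i))
    (hcγ : ∀ i, HasSameEnds o (c i) (γ i))
    (hB : ∀ i, ∀ᶠ n : ℕ in atTop, gromovProd o (γ i (-n)) (γ i n) ≤ 2 * M)
    (hcross : CrossProdLE o γ (2 * M)) (hzero : ∀ i, dist o (c i 0) ≤ 8 * L * M) :
    curveDist (γ 0) (γ 1) - 2 * (4 * δ + H * (D * v M + δ)) ≤ curveDist (c 0) (c 1) := by
  refine le_curveDist fun s₀ s₁ => ?_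
  have hδM := hS.delta_le_div hM
  have hδ := hS.delta_nonneg
  have hL := hS.one_lt
  have hM₁ : (1 : ℝ) ≤ M := hS.one_le.trans hM
  -- the scale that contains both parameters
  have key : ∀ m : ℝ≥0, M ≤ m → |s₀| ≤ m → |s₁| ≤ m → ∃ T : ℕ, R ≤ T ∧ A * m ≤ (T : ℝ≥0) ∧
      (T : ℝ≥0) ≤ 2 * (A * m) ∧ ∀ᶠ n : ℕ in atTop,
        gromovProd (c 0 s₀) (γ 0 (-n)) (γ 0 n) ≤ H * (v T + δ) + 2 * δ ∧
        gromovProd (c 1 s₁) (γ 1 (-n)) (γ 1 n) ≤ H * (v T + δ) + 2 * δ := by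
    intro m hm h₀ h₁
    have hAm : m ≤ A * m := le_mul_of_one_le_left zero_le hS.one_le_A
    obtain ⟨hT₁, hT₂⟩ := le_natCeil_and_le (((hS.one_le.trans hM).trans hm).trans hAm)
    set T : ℕ := ⌈A * m⌉₊
    have hT : R ≤ T := hM.trans (hm.trans (hAm.trans hT₁))
    have hmT : (m : ℝ) ≤ T := by exact_mod_cast hAm.trans hT₁
    have hsT : ∀ s : ℝ, |s| ≤ m → lam.2 * |s| ≤ lam.1 / 32 * T := by
      intro s hs
      have hT₁' : (A : ℝ) * m ≤ T := by exact_mod_cast hT₁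
      have e₁ := mul_le_mul_of_nonneg_left hs hS.snd_pos.le
      have e₂ := mul_le_mul_of_nonneg_right hS.snd_le (show (0 : ℝ) ≤ m by positivity)
      have e₃ := mul_le_mul_of_nonneg_left hT₁' hS.fst_pos.le
      linarith
    exact ⟨T, hT, hT₁, hT₂,
      (hS.eventually_gromovProd_le hY hMorse (hc 0) (hcγ 0) hT (h₀.trans hmT) (hsT _ h₀)).and
      (hS.eventually_gromovProd_le hY hMorse (hc 1) (hcγ 1) hT (h₁.trans hmT) (hsT _ h₁))⟩
  have hMC : M ≤ C * M := le_mul_of_one_le_left zero_le hS.one_le_C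
  by_cases hs : max |s₀| |s₁| ≤ C * M
  · obtain ⟨T, hT, -, hT₂, hev⟩ := key (C * M) hMC
      (by push_cast; exact (le_max_left _ _).trans hs)
      (by push_cast; exact (le_max_right _ _).trans hs)
    obtain ⟨n, hn₀, hn₁⟩ := hev.exists
    obtain ⟨τ₀, hτ₀⟩ := hY.exists_dist_le_of_isometry (hγ 0) (c 0 s₀) n
    obtain ⟨τ₁, hτ₁⟩ := hY.exists_dist_le_of_isometry (hγ 1) (c 1 s₁) n
    have hvT : H * (v T + δ) ≤ H * (D * v M + δ) :=
      mul_le_mul_of_nonneg_left (by linarith [hS.mono hT₂, hS.doubling M hM]) hS.morse_pos.le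
    have := curveDist_le (γ 0) (γ 1) τ₀ τ₁
    have := dist_triangle4_left (c 0 s₀) (c 1 s₁) (γ 0 τ₀) (γ 1 τ₁)
    linarith
  · push Not at hs
    set m : ℝ≥0 := ⟨max |s₀| |s₁|, (abs_nonneg _).trans (le_max_left _ _)⟩ with hm
    have hmc : (m : ℝ) = max |s₀| |s₁| := rfl
    have hCm : (C : ℝ) * M < m := hs
    have hMm : M ≤ m := hMC.trans (by exact_mod_cast hCm.le)
    obtain ⟨T, hT, hT₁, hT₂, hev⟩ := key m hMm (le_max_left _ _) (le_max_right _ _)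
    obtain ⟨n, ⟨hn₀, hn₁⟩, h₁, h₂, h₃, h₄⟩ := (hev.and hcross).exists
    have hfar := hY.le_dist_of_near_lines hδ hn₀ hn₁ h₁ h₂ h₃ h₄
    have hsix := hS.curveDist_le_six_mul hY hM hγ hB
    obtain ⟨-, hsmall⟩ := hS.morse_le_mul hT hT₂
    have hmT : (m : ℝ) ≤ T := by
      exact_mod_cast (le_mul_of_one_le_left zero_le hS.one_le_A).trans hT₁
    have hgrow : ∀ (i : Fin 2) (s : ℝ), |s| = m →
        lam.1 * m - (v T + δ) - 8 * L * M ≤ dist o (c i s) := by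
      intro i s hsm
      have hqg := (hc i).isQuasiGeodesicOn hS.mono (T := T) (K := v T + δ) (by linarith)
      have e₁ := (hqg s (abs_le.1 (hsm.le.trans (by exact_mod_cast hmT))) 0
        ⟨by simp, by simp⟩).1
      rw [sub_zero, hsm] at e₁
      have e₂ := dist_triangle_left (c i s) (c i 0) o
      linarith [hzero i]
    -- Only the curve with the larger parameter needs to have moved away from `o`.
    have hsum : lam.1 * m - (v T + δ) - 8 * L * M ≤ dist o (c 0 s₀) + dist o (c 1 s₁) := by
      rcases max_choice |s₀| |s₁| with h | h
      · linarith [hgrow 0 s₀ (h.symm.trans hmc.symm), dist_nonneg (x := o) (y := c 1 s₁)]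
      · linarith [hgrow 1 s₁ (h.symm.trans hmc.symm), dist_nonneg (x := o) (y := c 0 s₀)]
    have e₁ := mul_le_mul_of_nonneg_left hCm.le hS.fst_pos.le
    have e₂ := mul_le_mul_of_nonneg_right hS.le_C (show (0 : ℝ) ≤ M by positivity)
    have e₃ : 0 < v T + δ := (hS.bounds hT).2.2.2
    have e₄ := mul_pos hS.morse_pos e₃
    have e₅ : 0 ≤ H * (D * v M + δ) := by
      have hD : 0 ≤ D * v M := by
        linarith [hS.doubling M hM, hS.one_le_error (2 * (A * (C * M)))]
      exact mul_nonneg hS.morse_pos.le (by linarith)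
    have e₆ : (M : ℝ) ≤ L * M := le_mul_of_one_le_left (by positivity) hL.le
    linarith

theorem IsComparisonScale.abs_curveDist_sub_le (hS : IsComparisonScale lam v δ H ε R L A C D)
    (hY : IsGromovHyperbolic Y δ) (hMorse : HasMorseConstant Y lam.1 lam.2 δ H) (hM : R ≤ M)
    {c γ : Fin 2 → ℝ → Y} (hc : ∀ i, IsSublinearGeodesic lam v (c i)) (hγ : ∀ i, Isometry (γ i))
    (hcγ : ∀ i, HasSameEnds o (c i) (γ i))
    (hB : ∀ i, ∀ᶠ n : ℕ in atTop, gromovProd o (γ i (-n)) (γ i n) ≤ 2 * M)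
    (hcross : CrossProdLE o γ (2 * M))
    (hprox : ∀ i, dist o (c i 0) ≤ L * ⨅ t : ℝ, dist o (c i t)) :
    |curveDist (γ 0) (γ 1) - curveDist (c 0) (c 1)| ≤ (9 + 2 * H * (D + 1)) * (v M + δ) := by
  have hzero : ∀ i, dist o (c i 0) ≤ 8 * L * M := fun i =>
    hS.dist_zero_le hY hMorse hM (hc i) (hγ i) (hcγ i) (hB i) (hprox i)
  have h₁ := hS.curveDist_sublinear_le hY hMorse hM hc hγ hcγ hB hcross hzero
  have h₂ := hS.le_curveDist_sublinear hY hMorse hM hc hγ hcγ hB hcross hzero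
  have hv := hS.one_le_error M
  have hδ := hS.delta_nonneg
  have hD : 0 ≤ D := by
    by_contra! h
    nlinarith [hS.doubling M hM, hS.one_le_error (2 * (A * (C * M)))]
  have hH := hS.morse_pos
  have e₁ : 0 ≤ H * (D * δ) := by positivity
  have e₂ : 0 ≤ H * v M := by positivity
  rw [abs_le]
  constructor <;> linarith

end Comparison

/-! ### Choice of the scales and constants for an admissible error. -/

section Admissible

variable {u v : ℝ≥0 → ℝ}

theorem IsAdmissible.exists_two_mul_le (hv : IsAdmissible v) :
    ∃ D : ℝ, 1 ≤ D ∧ ∃ r₀ : ℝ≥0, ∀ r, r₀ ≤ r → v (2 * r) ≤ D * v r := by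
  obtain ⟨b, hb⟩ := hv.doubling
  obtain ⟨r₀, hr₀⟩ := eventually_atTop.1 (eventually_map.1 hb)
  refine ⟨max 1 b, le_max_left _ _, r₀, fun r hr => ?_⟩
  have hpos : 0 < v r := lt_of_lt_of_le one_pos (hv.one_le r)
  exact (div_le_iff₀ hpos).1 ((hr₀ r hr).trans (le_max_right _ _))

theorem IsAdmissible.sup (hu : IsAdmissible u) (hv : IsAdmissible v) : IsAdmissible (u ⊔ v) where
  one_le r := (hu.one_le r).trans le_sup_left
  mono := hu.mono.sup hv.mono
  doubling := by
    obtain ⟨D₁, hD₁, r₁, h₁⟩ := hu.exists_two_mul_le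
    obtain ⟨D₂, -, r₂, h₂⟩ := hv.exists_two_mul_le
    refine ⟨max D₁ D₂, eventually_map.2 ?_⟩
    filter_upwards [eventually_ge_atTop (max r₁ r₂)] with r hr
    have hu₀ : 0 ≤ u r := zero_le_one.trans (hu.one_le r)
    have hv₀ : 0 ≤ v r := zero_le_one.trans (hv.one_le r)
    have hpos : 0 < (u ⊔ v) r := lt_of_lt_of_le one_pos ((hu.one_le r).trans le_sup_left)
    have hD : 0 ≤ max D₁ D₂ := zero_le_one.trans (hD₁.trans (le_max_left _ _))
    rw [div_le_iff₀ hpos]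
    refine sup_le ?_ ?_
    · calc u (2 * r) ≤ D₁ * u r := h₁ r ((le_max_left _ _).trans hr)
        _ ≤ max D₁ D₂ * (u ⊔ v) r := mul_le_mul (le_max_left _ _) le_sup_left hu₀ hD
    · calc v (2 * r) ≤ D₂ * v r := h₂ r ((le_max_right _ _).trans hr)
        _ ≤ max D₁ D₂ * (u ⊔ v) r := mul_le_mul (le_max_right _ _) le_sup_right hv₀ hD
  sublinear := by
    rw [Asymptotics.isLittleO_iff]
    intro ε hε
    filter_upwards [hu.sublinear.bound hε, hv.sublinear.bound hε] with r h₁ h₂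
    rcases max_choice (u r) (v r) with h | h
    · rwa [Pi.sup_apply, h]
    · rwa [Pi.sup_apply, h]

theorem IsAdmissible.exists_mul_le (hv : IsAdmissible v) (a : ℝ≥0) :
    ∃ D : ℝ, 1 ≤ D ∧ ∃ r₀ : ℝ≥0, ∀ r, r₀ ≤ r → v (a * r) ≤ D * v r := by
  obtain ⟨D, hD, r₀, h⟩ := hv.exists_two_mul_le
  have hpow : ∀ k : ℕ, ∀ r, r₀ ≤ r → v (2 ^ k * r) ≤ D ^ k * v r := by
    intro k
    induction k with
    | zero => intro r _; simp
    | succ k ih =>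
      intro r hr
      have hr' : r₀ ≤ 2 ^ k * r :=
        hr.trans (le_mul_of_one_le_left zero_le (one_le_pow₀ one_le_two))
      calc v (2 ^ (k + 1) * r) = v (2 * (2 ^ k * r)) := by rw [pow_succ']; ring_nf
        _ ≤ D * v (2 ^ k * r) := h _ hr'
        _ ≤ D * (D ^ k * v r) := mul_le_mul_of_nonneg_left (ih r hr) (by linarith)
        _ = D ^ (k + 1) * v r := by rw [pow_succ']; ring
  obtain ⟨k, hk⟩ := pow_unbounded_of_one_lt a (one_lt_two (α := ℝ≥0))
  exact ⟨D ^ k, one_le_pow₀ hD, r₀, fun r hr =>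
    (hv.mono (mul_le_mul_left hk.le r)).trans (hpow k r hr)⟩

theorem IsSublinearGeodesic.mono {Y : Type*} [MetricSpace Y] {lam : ℝ × ℝ} {c : ℝ → Y}
    (hc : IsSublinearGeodesic lam u c) (huv : u ≤ v) : IsSublinearGeodesic lam v c := by
  intro s t
  have h := hc s t
  have := huv (max (nndist 0 s) (nndist 0 t))
  exact ⟨by linarith [h.1], by linarith [h.2]⟩

theorem IsAdmissible.exists_isComparisonScale (hv : IsAdmissible v) {lam : ℝ × ℝ}
    (h₁ : 0 < lam.1) (h₂ : 0 < lam.2) {L H : ℝ} (hL : 1 < L) (hH : 0 < H) :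
    ∃ (ε D : ℝ) (A C : ℝ≥0), 1 ≤ D ∧ ∀ δ : ℝ, 0 ≤ δ → ∃ R₀ : ℝ≥0, ∀ R, R₀ ≤ R →
      IsComparisonScale lam v δ H ε R L A C D := by
  obtain ⟨A, hA, hA'⟩ : ∃ A : ℝ≥0, 1 ≤ A ∧ (32 * lam.2 + 32) / lam.1 ≤ A :=
    ⟨max 1 ((32 * lam.2 + 32) / lam.1).toNNReal, le_max_left _ _,
      (Real.le_coe_toNNReal _).trans (NNReal.coe_le_coe.2 (le_max_right _ _))⟩
  obtain ⟨C, hC, hC'⟩ : ∃ C : ℝ≥0, 1 ≤ C ∧ 16 * (8 * L + 12) / lam.1 ≤ C :=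
    ⟨max 1 (16 * (8 * L + 12) / lam.1).toNNReal, le_max_left _ _,
      (Real.le_coe_toNNReal _).trans (NNReal.coe_le_coe.2 (le_max_right _ _))⟩
  obtain ⟨D, hD, r₀, hr₀⟩ := hv.exists_mul_le (2 * (A * C))
  have hA₁ : (1 : ℝ) ≤ A := hA
  rw [div_le_iff₀' h₁] at hA' hC'
  set q : ℝ := (1 + H) * A * L with hq
  have hqpos : 0 < q := by positivity
  -- With `v T + δ ≤ 4 * ε * A * m` for `T ≤ 2 * A * m`, this makes `(1 + H) * L * (v T + δ)` at
  -- most `min 1 lam.1 * m / 16`.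
  set ε : ℝ := min 1 lam.1 / (64 * q) with hε
  have hεpos : 0 < ε := by positivity
  have hεq : 64 * ((1 + H) * ε * A * L) = min 1 lam.1 := by
    rw [show 64 * ((1 + H) * ε * A * L) = ε * (64 * q) by rw [hq]; ring, hε]
    field_simp
  obtain ⟨r₁, hr₁⟩ := eventually_atTop.1 (hv.sublinear.bound hεpos)
  -- Only the threshold sees `δ`, through `δ / ε`; this is what later keeps `J` free of `δ`.
  refine ⟨ε, D, A, C, hD, fun δ hδ => ⟨max (max 1 r₀) (max r₁ (δ / ε).toNNReal), fun R hR => ?_⟩⟩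
  have hR₁ : 1 ≤ R := ((le_max_left _ _).trans (le_max_left _ _)).trans hR
  have hR₂ : r₀ ≤ R := ((le_max_right _ _).trans (le_max_left _ _)).trans hR
  have hR₃ : r₁ ≤ R := ((le_max_left _ _).trans (le_max_right _ _)).trans hR
  have hR₄ : (δ / ε).toNNReal ≤ R := ((le_max_right _ _).trans (le_max_right _ _)).trans hR
  exact
    { fst_pos := h₁
      snd_pos := h₂
      delta_nonneg := hδ
      morse_pos := hH
      eps_pos := hεpos
      one_le := hR₁
      one_le_error := hv.one_le
      mono := hv.mono
      error_le := fun r hr => by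
        have := hr₁ r (hR₃.trans hr)
        rw [Real.norm_eq_abs, Real.norm_eq_abs, NNReal.abs_eq] at this
        exact (le_abs_self _).trans this
      delta_le := by
        rw [← div_le_iff₀' hεpos]
        exact Real.toNNReal_le_iff_le_coe.1 hR₄
      eps_le := by
        have h : (1 + H) * ε * 1 * 1 ≤ (1 + H) * ε * A * L := by gcongr
        linarith [min_le_right 1 lam.1]
      one_lt := hL
      one_le_A := hA
      one_le_C := hC
      snd_le := by linarith
      le_A := by linarith
      le_C := hC'
      eps_le_one := hεq.le.trans (min_le_left _ _)
      eps_le_fst := hεq.le.trans (min_le_right _ _)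
      doubling := fun r hr => by
        have := hr₀ r (hR₂.trans hr)
        rwa [mul_assoc, mul_assoc] at this }

end Admissible

/-! ### Dependence of the constants on the data, and conclusion. -/

section Main

/-- The distance between two sublinear geodesics is within `J * v M` of the distance between the
geodesics with the same endpoints, when the Gromov products of the endpoints are bounded by
roughly `M` and `R ≤ M`. -/
def HasDistanceBound.{u} (lam : ℝ × ℝ) (v : ℝ≥0 → ℝ) (L δ J : ℝ) (R : ℝ≥0) : Prop :=
  ∀ (Y : Type u) [MetricSpace Y] (o : Y), IsGeodesicSpace Y → IsGromovHyperbolic Y δ →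
    ∀ (c γ : Fin 2 → ℝ → Y) (M : ℝ≥0), R ≤ M → (∀ i, IsSublinearGeodesic lam v (c i)) →
      (∀ i, Isometry (γ i)) → (∀ i, HasSameEnds o (c i) (γ i)) →
      (∀ i, ∀ᶠ n : ℕ in atTop, gromovProd o (γ i (-n)) (γ i n) ≤ M + 1 + 2 * δ) →
      CrossProdLE o γ (M + 1 + 2 * δ) →
      (∀ i, dist o (c i 0) ≤ L * ⨅ t : ℝ, dist o (c i t)) →
      |curveDist (γ 0) (γ 1) - curveDist (c 0) (c 1)| ≤ J * v M

/-- The factor `K` isolates the only way in which `δ` can enter the constant; `J₀` is fixed before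
`δ`. -/
theorem IsAdmissible.exists_hasDistanceBound.{u} {v : ℝ≥0 → ℝ} (hv : IsAdmissible v)
    {lam : ℝ × ℝ} (h₁ : 0 < lam.1) (h₂ : 0 < lam.2) {L : ℝ} (hL : 1 < L) :
    ∃ J₀ : ℝ, 0 < J₀ ∧ ∀ δ : ℝ, 0 ≤ δ → ∃ R₀ : ℝ≥0, ∀ R, R₀ ≤ R → ∀ K : ℝ,
      (∀ M, R ≤ M → v M + δ ≤ K * v M) → HasDistanceBound.{u} lam v L δ (J₀ * K) R := by
  obtain ⟨H, hH, hmorse⟩ := exists_hasMorseConstant.{u} h₁ h₂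
  obtain ⟨ε, D, A, C, hD, hscale⟩ := hv.exists_isComparisonScale h₁ h₂ hL hH
  have hJ : 0 < 9 + 2 * H * (D + 1) := by positivity
  refine ⟨9 + 2 * H * (D + 1), hJ, fun δ hδ => ?_⟩
  obtain ⟨R₀, hR₀⟩ := hscale δ hδ
  refine ⟨max R₀ (1 + 2 * δ).toNNReal, fun R hR K hK => ?_⟩
  intro Y _ o hG hY c γ M hM hc hγ hcγ hB hcross hprox
  have hS := hR₀ R ((le_max_left _ _).trans hR)
  have hle : (M : ℝ) + 1 + 2 * δ ≤ 2 * M := by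
    have : 1 + 2 * δ ≤ M := Real.toNNReal_le_iff_le_coe.1 ((le_max_right _ _).trans (hR.trans hM))
    linarith
  refine (hS.abs_curveDist_sub_le hY (hmorse Y δ hδ hG hY) hM hc hγ hcγ
    (fun i => (hB i).mono fun n hn => hn.trans hle)
    (hcross.mono fun n hn => ⟨hn.1.trans hle, hn.2.1.trans hle, hn.2.2.1.trans hle,
      hn.2.2.2.trans hle⟩) hprox).trans ?_
  rw [mul_assoc _ K]
  exact mul_le_mul_of_nonneg_left (hK M hM) hJ.le

/-- The constants of the distance bound; the first one does not depend on the hyperbolicity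
constant if `v` is unbounded. -/
theorem exists_constants.{u} (lam : ℝ × ℝ) (v : ℝ≥0 → ℝ) (L : ℝ) :
    ∃ J R : ℝ → ℝ, (∀ δ, 0 < J δ ∧ 0 < R δ) ∧
      (¬ BddAbove (Set.range v) → ∀ δ δ', J δ = J δ') ∧
      (IsAdmissible v → 0 < lam.1 → 0 < lam.2 → 1 < L → ∀ δ, 0 ≤ δ →
        HasDistanceBound.{u} lam v L δ (J δ) (R δ).toNNReal) := by
  by_cases h : IsAdmissible v ∧ 0 < lam.1 ∧ 0 < lam.2 ∧ 1 < L
  swap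
  -- The constants are total functions, so data outside the hypotheses get the value `1`.
  · exact ⟨fun _ => 1, fun _ => 1, fun _ => ⟨one_pos, one_pos⟩, fun _ _ _ => rfl,
      fun h₁ h₂ h₃ h₄ => absurd ⟨h₁, h₂, h₃, h₄⟩ h⟩
  obtain ⟨hv, h₁, h₂, hL⟩ := h
  obtain ⟨J₀, hJ₀, hex⟩ := hv.exists_hasDistanceBound.{u} h₁ h₂ hL
  by_cases hbdd : BddAbove (Set.range v)
  -- For bounded `v`, `1 ≤ v` gives `v M + δ ≤ (1 + δ) * v M`; the absolute value keeps the constant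
  -- positive for negative `δ`.
  · have hR : ∀ δ : ℝ, ∃ R : ℝ, 0 < R ∧
        (0 ≤ δ → HasDistanceBound.{u} lam v L δ (J₀ * (1 + |δ|)) R.toNNReal) := by
      intro δ
      by_cases hδ : 0 ≤ δ
      · obtain ⟨R₀, hR₀⟩ := hex δ hδ
        refine ⟨R₀ + 1, by positivity, fun _ => hR₀ _ ?_ _ fun M _ => ?_⟩
        · exact NNReal.le_toNNReal_of_coe_le (by simp)
        · rw [abs_of_nonneg hδ]
          nlinarith [hv.one_le M]
      · exact ⟨1, one_pos, fun h => absurd h hδ⟩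
    choose R hR₀ hR using hR
    exact ⟨fun δ => J₀ * (1 + |δ|), R, fun δ => ⟨by positivity, hR₀ δ⟩, fun h => absurd hbdd h,
      fun _ _ _ _ => hR⟩
  · have hR : ∀ δ : ℝ, ∃ R : ℝ, 0 < R ∧
        (0 ≤ δ → HasDistanceBound.{u} lam v L δ (J₀ * 2) R.toNNReal) := by
      intro δ
      by_cases hδ : 0 ≤ δ
      · obtain ⟨R₀, hR₀⟩ := hex δ hδ
        -- Past a point `r` with `δ < v r`, `K = 2` suffices, so `δ` moves into the threshold.
        obtain ⟨_, ⟨r, rfl⟩, hr⟩ := not_bddAbove_iff.1 hbdd δ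
        refine ⟨R₀ + r + 1, by positivity, fun _ => hR₀ _ ?_ _ fun M hM => ?_⟩
        · exact NNReal.le_toNNReal_of_coe_le (by linarith [r.coe_nonneg])
        · have hrM : (r : ℝ) ≤ M := by
            have := Real.toNNReal_le_iff_le_coe.1 hM
            linarith [R₀.coe_nonneg]
          linarith [hv.mono (NNReal.coe_le_coe.1 hrM)]
      · exact ⟨1, one_pos, fun h => absurd h hδ⟩
    choose R hR₀ hR using hR
    exact ⟨fun _ => J₀ * 2, R, fun δ => ⟨by positivity, hR₀ δ⟩, fun _ _ _ => rfl,
      fun _ _ _ _ => hR⟩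

theorem maxProd_ne_top {Y : Type*} [MetricSpace Y] {δ : ℝ} (hY : IsGromovHyperbolic Y δ) {o : Y}
    {η : Fin 4 → GromovBoundary o} (hη : Function.Injective η) : maxProd η ≠ ⊤ := by
  obtain ⟨i, hi⟩ := exists_eq_ciSup_of_finite
    (f := fun i => ⨆ (j : Fin 4) (_ : i ≠ j), boundaryProd (η i) (η j))
  obtain ⟨j, hj⟩ := exists_eq_ciSup_of_finite
    (f := fun j => ⨆ (_ : i ≠ j), boundaryProd (η i) (η j))
  unfold maxProd
  rw [← hi, ← hj]
  by_cases hij : i = j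
  · simp [hij]
  · simpa [hij] using boundaryProd_ne_top hY (hη.ne hij)

end Main

theorem mainTheorem10 :
    ∃ (J R : ℝ → ℝ × ℝ → (ℝ≥0 → ℝ) → ℝ → ℝ)
      (Rt : Fin 2 → ℝ → ℝ × ℝ → (ℝ≥0 → ℝ) → ℝ → ℝ),
      -- the constants are positive
      (∀ δ lam v L, 0 < J δ lam v L ∧ 0 < R δ lam v L ∧ ∀ i, 0 < Rt i δ lam v L) ∧
      -- `J` depends on `lam`, `v`, `L` only, unless `v` is bounded
      (∀ lam v L, ¬ BddAbove (Set.range v) → ∀ δ δ' : ℝ, J δ lam v L = J δ' lam v L) ∧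
      ∀ (vv : Fin 2 → ℝ≥0 → ℝ) (v : ℝ≥0 → ℝ) (L δ : ℝ) (lam : ℝ × ℝ),
        (∀ i, IsAdmissible (vv i)) → v = vv 0 ⊔ vv 1 → 1 < L → 0 ≤ δ →
        0 < lam.1 → 0 < lam.2 →
        ∀ (Y : Type*) [MetricSpace Y] [ProperSpace Y] (o : Y),
          IsGeodesicSpace Y → IsGromovHyperbolic Y δ →
          ∀ (γ γt : Fin 2 → ℝ → Y) (η : Fin 4 → GromovBoundary o),
            -- (i) `γ 0`, `γ 1` are geodesics with four distinct endpoints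
            (∀ i, Isometry (γ i)) →
            Function.Injective η →
            HasEndpointNeg (γ 0) (η 0) → HasEndpointPos (γ 0) (η 1) →
            HasEndpointNeg (γ 1) (η 2) → HasEndpointPos (γ 1) (η 3) →
            -- (ii) `γt i` is a `(lam, vv i)`-geodesic
            (∀ i, IsSublinearGeodesic lam (vv i) (γt i)) →
            -- (iii) `γt i` and `γ i` have the same endpoints
            HasEndpointNeg (γt 0) (η 0) → HasEndpointPos (γt 0) (η 1) →
            HasEndpointNeg (γt 1) (η 2) → HasEndpointPos (γt 1) (η 3) →
            -- (iv) the Gromov products are large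
            ENNReal.ofReal (60 * δ) ≤ minProd η →
            ENNReal.ofReal (R δ lam v L) ≤ maxProd η →
            -- (v) proximity
            (∀ i, Rt i δ lam (vv i) L ≤ dist o (γt i 0) ∧
              dist o (γt i 0) ≤ L * ⨅ t : ℝ, dist o (γt i t)) →
            |curveDist (γ 0) (γ 1) - curveDist (γt 0) (γt 1)|
              ≤ J δ lam v L * v (maxProd η).toNNReal := by
  -- no lower bound on the distance from the base-point to the curves is needed beyond `hprox`,
  -- so the constants of the proximity condition can be taken to be `1`
  choose J R hpos hindep hbound using exists_constants.{u_1}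
  refine ⟨fun δ lam v L => J lam v L δ, fun δ lam v L => R lam v L δ, fun _ _ _ _ _ => 1,
    fun δ lam v L => ⟨(hpos lam v L δ).1, (hpos lam v L δ).2, fun _ => one_pos⟩, hindep, ?_⟩
  intro vv v L δ lam hvv hv hL hδ h₁ h₂ Y _ _ o hG hY γ γt η hγ hη e₀ e₁ e₂ e₃ hγt f₀ f₁ f₂ f₃
    _ hR hprox
  have hadm : IsAdmissible v := hv ▸ (hvv 0).sup (hvv 1)
  have hle : ∀ i, vv i ≤ v := by
    rw [hv, Fin.forall_fin_two]
    exact ⟨le_sup_left, le_sup_right⟩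
  have hfin := maxProd_ne_top hY hη
  have hmax : ∀ i j, i ≠ j → boundaryProd (η i) (η j) ≤ (maxProd η).toNNReal := by
    intro i j hij
    rw [ENNReal.coe_toNNReal hfin]
    exact le_iSup_of_le i (le_iSup_of_le j (le_iSup_of_le hij le_rfl))
  have hprod : ∀ {x y : ℕ → Y} {i j : Fin 4}, i ≠ j → Represents x (η i) → Represents y (η j) →
      ∀ᶠ n in atTop, gromovProd o (x n) (y n) ≤ (maxProd η).toNNReal + 1 + 2 * δ := by
    intro x y i j hij hx hy
    obtain ⟨N, hN⟩ := hx.exists_le_of_boundaryProd_le hY hδ hy (hmax i j hij)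
    filter_upwards [eventually_ge_atTop N] with n hn using hN n hn n hn
  refine hbound lam v L hadm h₁ h₂ hL δ hδ Y o hG hY γt γ (maxProd η).toNNReal ?_
    (fun i => (hγt i).mono (hle i)) hγ ?_ ?_ ?_ fun i => (hprox i).2
  · rw [← ENNReal.coe_le_coe, ENNReal.coe_toNNReal hfin]
    exact hR
  · rw [Fin.forall_fin_two]
    exact ⟨⟨f₁.exists_le hY e₁, f₀.exists_le hY e₀⟩, ⟨f₃.exists_le hY e₃, f₂.exists_le hY e₂⟩⟩
  · rw [Fin.forall_fin_two]
    exact ⟨hprod (by decide) e₀ e₁, hprod (by decide) e₂ e₃⟩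
  · filter_upwards [hprod (by decide) e₀ e₂, hprod (by decide) e₀ e₃, hprod (by decide) e₁ e₂,
      hprod (by decide) e₁ e₃] with n g₁ g₂ g₃ g₄
    exact ⟨g₁, g₂, g₃, g₄⟩
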